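/- All graphs are finite and simple. A set $D\subseteq V(G)$ is a dominating set of a graph $G$ if every vertex outside $D$ has a neighbour in $D$; the domination number $\gamma(G)$ is the minimum cardinality of a dominating set of $G$. A graph is bridgeless connected if it is connected and remains connected after the deletion of any single edge. An orientation of $G$ assigns to each edge exactly one of its two directions; its diameter is the maximum, over all ordered pairs $(u,v)$ of vertices, of the length of a shortest directed path from $u$ to $v$ (it is $\infty$ if the orientation is not strongly connected). The minimum oriented diameter $\overrightarrow{\mathrm{diam}}_{\min}(G)$ is the minimum of the diameters of all orientations of $G$. For $\gamma\in\mathbb{N}$ let $$\Xi(\gamma):=\max\left\{\overrightarrow{\mathrm{diam}}_{\min}(G)\,:\,G\text{ is a bridgeless connected graph with }\gamma(G)\le\gamma\right\}.$$ **Lemma.** The maximum defining $\Xi(3)$ exists, and $\Xi(3)=11$. -/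

import Mathlib

/-- `D` is a dominating set of `G`: every vertex outside `D` has a neighbour in `D`. -/
def SimpleGraph.IsDominatingSet {V : Type*} (G : SimpleGraph V) (D : Finset V) : Prop :=
  ∀ u : V, u ∉ D → ∃ v ∈ D, G.Adj u v

/-- The domination number of a (finite) graph: the smallest cardinality of a dominating set. -/
noncomputable def SimpleGraph.dominationNumber {V : Type*} (G : SimpleGraph V) : ℕ :=
  sInf {k : ℕ | ∃ D : Finset V, G.IsDominatingSet D ∧ D.card = k}

/-- `G` is connected, and it stays connected when any one of its edges is deleted. -/
def SimpleGraph.IsBridgelessConnected {V : Type*} (G : SimpleGraph V) : Prop :=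
  G.Connected ∧ ∀ e ∈ G.edgeSet, (G.deleteEdges {e}).Connected

/-- `H` is an orientation of `G`: every arc of `H` comes from an edge of `G`, and every edge of `G`
gets exactly one of its two directions. -/
def Digraph.IsOrientationOf {V : Type*} (H : Digraph V) (G : SimpleGraph V) : Prop :=
  (∀ u v : V, H.Adj u v → G.Adj u v) ∧
    ∀ u v : V, G.Adj u v → Xor (H.Adj u v) (H.Adj v u)

/-- `H.HasWalk u v n`: there is a directed walk with `n` arcs from `u` to `v` in `H`. -/
inductive Digraph.HasWalk {V : Type*} (H : Digraph V) : V → V → ℕ → Prop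
  | nil (u : V) : Digraph.HasWalk H u u 0
  | cons {u v w : V} {n : ℕ} (huv : H.Adj u v) (hvw : Digraph.HasWalk H v w n) :
      Digraph.HasWalk H u w (n + 1)

/-- The directed distance from `u` to `v`: the least length of a directed walk from `u` to `v`,
and `⊤` if there is none. -/
noncomputable def Digraph.dist {V : Type*} (H : Digraph V) (u v : V) : ℕ∞ :=
  ⨅ (n : ℕ) (_ : H.HasWalk u v n), (n : ℕ∞)

/-- The diameter of a digraph. For a finite digraph it is finite exactly when the digraph is
strongly connected. -/
noncomputable def Digraph.diam {V : Type*} (H : Digraph V) : ℕ∞ :=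
  ⨆ (u : V) (v : V), H.dist u v

/-- The minimum oriented diameter of `G`: the least diameter of an orientation of `G`.
Orientations that are not strongly connected have diameter `⊤` and do not contribute. -/
noncomputable def SimpleGraph.minOrientedDiam {V : Type*} (G : SimpleGraph V) : ℕ∞ :=
  ⨅ (H : Digraph V) (_ : H.IsOrientationOf G), H.diam

/-- The minimum oriented diameters of all finite bridgeless connected simple graphs with domination
number at most `γ`. -/
def orientedDiamValues (γ : ℕ) : Set ℕ∞ :=
  {d | ∃ (V : Type) (_ : Finite V) (G : SimpleGraph V),
    G.IsBridgelessConnected ∧ G.dominationNumber ≤ γ ∧ G.minOrientedDiam = d}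

/-- `Ξ(γ)`: the largest minimum oriented diameter of a bridgeless connected graph with domination
number at most `γ`. -/
noncomputable def Xi (γ : ℕ) : ℕ∞ :=
  sSup (orientedDiamValues γ)

/-! Upper bound. A bridgeless graph on at least three vertices with domination number at most 3
splits into three stars with dominating centres. It suffices to orient a small core containing the
centres so that centres are within 7 of each other, a centre and a core vertex within 9 both ways,
and two core vertices within 11. Every vertex outside can then be attached so that it reaches some
centre in 2 steps and is reached from some centre in 2 steps; 2 + 7 + 2 = 2 + 9 = 11
(`hasOrientation_of_core`).

Subdividing every edge that leaves a class at a centre can only make the problem harder, so all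
edges between classes may be taken to join non-centres (links). If every two classes are linked, a
system of links with the fewest coincident ends gives a core (`hasOrientation_of_links`). Otherwise
two classes are linked only to the third, and two-edge cuts leave few ways of attachment
(`hasOrientation_of_no_link`). Each resulting core is a fixed finite pattern whose distances are
checked by computation (`hasOrientation_of_pattern`).

Lower bound. In a chain of cycles of lengths 3, 3, 4, 4, 3, 3, a strong orientation makes every
cycle directed. Choose outer vertices at distance 2 to, respectively from, the attachment vertex of
each end triangle. The two opposite traversals of the chain cost 2 + a + 2 + 2 + b + 2 and 2 + (3 -
a) + 2 + 2 + (3 - b) + 2, where a and b are the costs of the inner triangles. The sum is 22, so one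
traversal has length at least 11. -/

namespace Digraph

/-! ### Directed walks of bounded length. -/

variable {V : Type*}

/-- There is a directed walk with at most `n` arcs from `u` to `v`. -/
def Near (H : Digraph V) (n : ℕ) (u v : V) : Prop := ∃ m ≤ n, H.HasWalk u v m

theorem HasWalk.append {H : Digraph V} {u v w : V} {m n : ℕ} (h : H.HasWalk u v m)
    (h' : H.HasWalk v w n) : H.HasWalk u w (m + n) := by
  induction h with
  | nil => simpa using h'
  | cons huv _ ih =>
    have := HasWalk.cons huv (ih h')
    rwa [Nat.add_right_comm]

theorem HasWalk.map {W : Type*} {H : Digraph V} {K : Digraph W} (φ : V → W)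
    (hφ : ∀ u v, H.Adj u v → K.Adj (φ u) (φ v)) {u v : V} {n : ℕ} (h : H.HasWalk u v n) :
    K.HasWalk (φ u) (φ v) n := by
  induction h with
  | nil => exact .nil _
  | cons huv _ ih => exact .cons (hφ _ _ huv) ih

theorem Near.refl (H : Digraph V) (n : ℕ) (u : V) : H.Near n u u := ⟨0, n.zero_le, .nil u⟩

theorem Near.trans {H : Digraph V} {u v w : V} {m n : ℕ} (h : H.Near m u v) (h' : H.Near n v w) :
    H.Near (m + n) u w := by
  obtain ⟨a, ha, h⟩ := h
  obtain ⟨b, hb, h'⟩ := h'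
  exact ⟨a + b, by omega, h.append h'⟩

theorem Near.mono {H : Digraph V} {u v : V} {m n : ℕ} (h : H.Near m u v) (hmn : m ≤ n) :
    H.Near n u v := by
  obtain ⟨a, ha, h⟩ := h
  exact ⟨a, ha.trans hmn, h⟩

theorem Near.map {W : Type*} {H : Digraph V} {K : Digraph W} (φ : V → W)
    (hφ : ∀ u v, H.Adj u v → K.Adj (φ u) (φ v)) {u v : V} {n : ℕ} (h : H.Near n u v) :
    K.Near n (φ u) (φ v) := by
  obtain ⟨a, ha, h⟩ := h
  exact ⟨a, ha, h.map φ hφ⟩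

theorem Near.of_adj {H : Digraph V} {u v : V} (h : H.Adj u v) : H.Near 1 u v :=
  ⟨1, le_rfl, .cons h (.nil v)⟩

theorem Near.of_adj_adj {H : Digraph V} {u v w : V} (h : H.Adj u v) (h' : H.Adj v w) :
    H.Near 2 u w :=
  (Near.of_adj h).trans (Near.of_adj h')

theorem dist_le_of_near {H : Digraph V} {u v : V} {n : ℕ} (h : H.Near n u v) : H.dist u v ≤ n := by
  obtain ⟨m, hm, h⟩ := h
  exact (iInf₂_le m h).trans (by exact_mod_cast hm)

theorem near_of_dist_le {H : Digraph V} {u v : V} {n : ℕ} (h : H.dist u v ≤ n) : H.Near n u v := by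
  by_contra hn
  have : ((n + 1 : ℕ) : ℕ∞) ≤ H.dist u v := by
    refine le_iInf₂ fun m hm => ?_
    by_contra hlt
    refine hn ⟨m, ?_, hm⟩
    have : m < n + 1 := by exact_mod_cast not_le.mp hlt
    omega
  have := this.trans h
  have : n + 1 ≤ n := by exact_mod_cast this
  omega

theorem near_of_diam_le {H : Digraph V} {n : ℕ} (h : H.diam ≤ n) (u v : V) : H.Near n u v :=
  near_of_dist_le ((le_iSup₂ (f := fun u v => H.dist u v) u v).trans h)

end Digraph

/-! ### Partial orientations, edge cuts, and extending a core. -/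

namespace SimpleGraph

variable {V : Type*}

/-- Some partial orientation of `G` already has diameter at most `n`. -/
def HasOrientation (G : SimpleGraph V) (n : ℕ) : Prop :=
  ∃ H : Digraph V, (∀ u v, H.Adj u v → G.Adj u v) ∧ (∀ u v, H.Adj u v → ¬ H.Adj v u) ∧
    ∀ u v, H.Near n u v

theorem HasOrientation.minOrientedDiam_le {G : SimpleGraph V} {n : ℕ} (h : G.HasOrientation n) :
    G.minOrientedDiam ≤ n := by
  obtain ⟨H, hsub, hasymm, hnear⟩ := h
  let K : Digraph V := ⟨fun u v => H.Adj u v ∨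
    (G.Adj u v ∧ ¬ H.Adj v u ∧ WellOrderingRel u v)⟩
  have hK : K.IsOrientationOf G := by
    refine ⟨fun u v huv => huv.elim (hsub u v) fun h => h.1, fun u v huv => ?_⟩
    have hvu := huv.symm
    have hirr : ¬ (WellOrderingRel u v ∧ WellOrderingRel v u) := fun h =>
      asymm_of WellOrderingRel h.1 h.2
    have htri : WellOrderingRel u v ∨ WellOrderingRel v u := by
      rcases trichotomous_of WellOrderingRel u v with h | h | h
      · exact .inl h
      · exact (huv.ne h).elim
      · exact .inr h
    have h1 := hasymm u v
    simp only [K, Xor]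
    tauto
  refine (iInf₂_le K hK).trans (iSup₂_le fun u v => Digraph.dist_le_of_near ?_)
  have hHK : ∀ u v, H.Adj u v → K.Adj u v := fun _ _ h => Or.inl h
  exact (hnear u v).map id hHK

/-- Every edge cut of `G` has at least two edges: an edge can be found that avoids a given one. -/
def TwoEdgeCuts (G : SimpleGraph V) : Prop :=
  ∀ (X : Set V) (a₀ b₀ : V), X.Nonempty → Xᶜ.Nonempty →
    ∃ a ∈ X, ∃ b ∉ X, G.Adj a b ∧ ¬ (a = a₀ ∧ b = b₀)

theorem Connected.exists_adj_mem_notMem {G : SimpleGraph V} (h : G.Connected) {X : Set V}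
    (hX : X.Nonempty) (hX' : Xᶜ.Nonempty) : ∃ a ∈ X, ∃ b ∉ X, G.Adj a b := by
  obtain ⟨x, hx⟩ := hX
  obtain ⟨y, hy⟩ := hX'
  obtain ⟨p⟩ := h.preconnected x y
  obtain ⟨e, -, h1, h2⟩ := p.exists_boundary_dart X hx hy
  exact ⟨_, h1, _, h2, e.adj⟩

theorem IsBridgelessConnected.twoEdgeCuts {G : SimpleGraph V} (h : G.IsBridgelessConnected) :
    G.TwoEdgeCuts := by
  intro X a₀ b₀ hX hX'
  by_cases hadj : G.Adj a₀ b₀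
  · obtain ⟨a, ha, b, hb, hab⟩ := (h.2 s(a₀, b₀) hadj).exists_adj_mem_notMem hX hX'
    rw [deleteEdges_adj] at hab
    refine ⟨a, ha, b, hb, hab.1, ?_⟩
    rintro ⟨rfl, rfl⟩
    exact hab.2 rfl
  · obtain ⟨a, ha, b, hb, hab⟩ := h.1.exists_adj_mem_notMem hX hX'
    refine ⟨a, ha, b, hb, hab, ?_⟩
    rintro ⟨rfl, rfl⟩
    exact hadj hab

/-- The vertices of `G` are partitioned into three classes, each of which is spanned by a star with
centre `d i`, and all edge cuts of `G` have at least two edges. -/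
structure StarPartition (G : SimpleGraph V) (d : Fin 3 → V) (f : V → Fin 3) : Prop where
  class_center : ∀ i, f (d i) = i
  adj_center : ∀ x, x ≠ d (f x) → G.Adj (d (f x)) x
  cut : G.TwoEdgeCuts

namespace StarPartition

variable {G : SimpleGraph V} {d : Fin 3 → V} {f : V → Fin 3}

theorem exists_adj_ne (S : G.StarPartition d f) (x y : V) : ∃ z, G.Adj x z ∧ z ≠ y := by
  have hne : ({x} : Set V)ᶜ.Nonempty := by
    by_contra h
    rw [Set.not_nonempty_iff_eq_empty, Set.compl_empty_iff] at h
    have h0 : d 0 ∈ ({x} : Set V) := h ▸ Set.mem_univ _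
    have h1 : d 1 ∈ ({x} : Set V) := h ▸ Set.mem_univ _
    have : d 0 = d 1 := h0.trans h1.symm
    have := congrArg f this
    simp [S.class_center] at this
  obtain ⟨a, ha, b, -, hab, hne⟩ := S.cut {x} x y ⟨x, rfl⟩ hne
  obtain rfl : a = x := ha
  exact ⟨b, hab, fun h => hne ⟨rfl, h⟩⟩

/-- A partial orientation on a vertex set containing the centres extends to the remaining
vertices. -/
theorem hasOrientation_of_core [Finite V] (S : G.StarPartition d f) (K : Set V) (H : Digraph V)
    (hK : ∀ u v, H.Adj u v → u ∈ K ∧ v ∈ K) (hsub : ∀ u v, H.Adj u v → G.Adj u v)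
    (hasymm : ∀ u v, H.Adj u v → ¬ H.Adj v u) (hd : ∀ i, d i ∈ K)
    (hlab : ∀ s ∈ K, (∃ i, s = d i ∨ H.Adj s (d i)) ∨ ∃ i, H.Adj (d i) s)
    (hdd : ∀ i j, H.Near 7 (d i) (d j)) (hds : ∀ i, ∀ s ∈ K, H.Near 9 (d i) s)
    (hsd : ∀ i, ∀ s ∈ K, H.Near 9 s (d i)) (hss : ∀ s ∈ K, ∀ t ∈ K, H.Near 11 s t) :
    G.HasOrientation 11 := by
  classical
  -- `A` is a maximal independent set of the graph induced outside `K`. There, arcs run from `A` to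
  -- its complement, so a non-isolated vertex has a neighbour of the other kind through which to
  -- leave or arrive.
  obtain ⟨A, ⟨hAK, hAind⟩, hAmax⟩ := (Set.toFinite
    {A : Set V | (∀ x ∈ A, x ∉ K) ∧ ∀ x ∈ A, ∀ y ∈ A, ¬ G.Adj x y}).exists_maximal
    ⟨∅, by simp⟩
  have hA : ∀ x, x ∉ K → x ∉ A → ∃ y ∈ A, G.Adj x y := by
    intro x hxK hxA
    by_contra! hno
    refine hxA (hAmax (y := insert x A) ⟨?_, ?_⟩ (Set.subset_insert x A) (Set.mem_insert x A))
    · rintro y (rfl | hy)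
      exacts [hxK, hAK y hy]
    · rintro y (rfl | hy) z (rfl | hz)
      exacts [G.irrefl, hno z hz, fun h => hno y hy h.symm, hAind y hy z hz]
  let iso : V → Prop := fun x => ∀ y, y ∉ K → ¬ G.Adj x y
  choose g hg hgne using fun x => S.exists_adj_ne x (d (f x))
  have hgK : ∀ x, iso x → g x ∈ K := fun x hx => by
    by_contra h
    exact hx _ h (hg x)
  -- `Out x` means that the spoke at `x` points away from the centre. A vertex with no neighbour
  -- outside `K` uses its second core neighbour `g x` instead, and the label of `g x` decides
  -- whether the path through `x` runs from its own centre to `g x` or back.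
  let Out : V → Prop := fun x =>
    (iso x ∧ ∃ i, g x = d i ∨ H.Adj (g x) (d i)) ∨ (¬ iso x ∧ x ∈ A)
  have hdne : ∀ x, x ∉ K → x ≠ d (f x) := fun x hx h => hx (h ▸ hd _)
  let H' : Digraph V := ⟨fun u v => H.Adj u v ∨ (u ∉ K ∧ v ∉ K ∧ G.Adj u v ∧ u ∈ A ∧ v ∉ A) ∨
    (v ∉ K ∧ Out v ∧ u = d (f v)) ∨ (u ∉ K ∧ ¬ Out u ∧ v = d (f u)) ∨
    (u ∉ K ∧ iso u ∧ Out u ∧ v = g u) ∨ (v ∉ K ∧ iso v ∧ ¬ Out v ∧ u = g v)⟩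
  have hHH' : ∀ u v, H.Adj u v → H'.Adj u v := fun u v h => .inl h
  have hout : ∀ x, x ∉ K → ∃ i, H'.Near 2 x (d i) := by
    intro x hx
    by_cases ho : Out x
    · rcases id ho with ⟨hi, i, h | h⟩ | ⟨hi, hxA⟩
      · refine ⟨i, (Digraph.Near.of_adj ?_).mono one_le_two⟩
        exact .inr (.inr (.inr (.inr (.inl ⟨hx, hi, ho, h.symm⟩))))
      · exact ⟨i, .of_adj_adj (v := g x) (.inr (.inr (.inr (.inr (.inl ⟨hx, hi, ho, rfl⟩)))))
          (hHH' _ _ h)⟩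
      · simp only [iso, not_forall, not_not] at hi
        obtain ⟨y, hyK, hxy⟩ := hi
        have hyA : y ∉ A := fun h => hAind x hxA y h hxy
        refine ⟨f y, .of_adj_adj (v := y) (.inr (.inl ⟨hx, hyK, hxy, hxA, hyA⟩))
          (.inr (.inr (.inr (.inl ⟨hyK, ?_, rfl⟩))))⟩
        rintro (⟨h, -⟩ | ⟨-, h⟩)
        exacts [h x hx hxy.symm, hyA h]
    · have h : H'.Adj x (d (f x)) := .inr (.inr (.inr (.inl ⟨hx, ho, rfl⟩)))
      exact ⟨f x, (Digraph.Near.of_adj h).mono one_le_two⟩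
  have hin : ∀ x, x ∉ K → ∃ i, H'.Near 2 (d i) x := by
    intro x hx
    by_cases ho : Out x
    · have h : H'.Adj (d (f x)) x := .inr (.inr (.inl ⟨hx, ho, rfl⟩))
      exact ⟨f x, (Digraph.Near.of_adj h).mono one_le_two⟩
    · by_cases hi : iso x
      · rcases hlab _ (hgK x hi) with h | ⟨i, h⟩
        · exact (ho (.inl ⟨hi, h⟩)).elim
        · exact ⟨i, .of_adj_adj (hHH' _ _ h) (.inr (.inr (.inr (.inr (.inr ⟨hx, hi, ho, rfl⟩)))))⟩
      · have hxA : x ∉ A := fun h => ho (.inr ⟨hi, h⟩)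
        obtain ⟨y, hyA, hxy⟩ := hA x hx hxA
        have hyK := hAK y hyA
        refine ⟨f y, .of_adj_adj (v := y) (.inr (.inr (.inl ⟨hyK, .inr ⟨?_, hyA⟩, rfl⟩)))
          (.inr (.inl ⟨hyK, hx, hxy.symm, hyA, hxA⟩))⟩
        exact fun h => h x hx hxy.symm
  have lift : ∀ {n u v}, H.Near n u v → H'.Near n u v := fun h => h.map id hHH'
  refine ⟨H', ?_, ?_, ?_⟩
  · rintro u v (h | h | ⟨hv, -, rfl⟩ | ⟨hu, -, rfl⟩ | ⟨-, -, -, rfl⟩ | ⟨-, -, -, rfl⟩)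
    · exact hsub u v h
    · exact h.2.2.1
    · exact S.adj_center v (hdne v hv)
    · exact (S.adj_center u (hdne u hu)).symm
    · exact hg u
    · exact (hg v).symm
  · intro u v h h'
    -- The new kinds of arcs use different edges: `g x` differs from the centre of the class of `x`,
    -- so the spoke and the edge to `g x` never coincide.
    have hu := hK u v
    have hv := hK v u
    have := hasymm u v
    have := hgne u
    have := hgne v
    have := hgK u
    have := hgK v
    have := hd (f u)
    have := hd (f v)
    simp only [H'] at h h'
    clear hHH' hout hin lift H' hss hsd hds hdd hlab hA hAmax hsub hK hasymm hd hgK hgne hdne hAK hAind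
    clear_value iso Out
    grind
  -- The four cases cost 11, 9 + 2, 2 + 9 and 2 + 7 + 2.
  · intro x y
    by_cases hx : x ∈ K <;> by_cases hy : y ∈ K
    · exact lift (hss x hx y hy)
    · obtain ⟨i, hi⟩ := hin y hy
      exact (lift (hsd i x hx)).trans hi
    · obtain ⟨i, hi⟩ := hout x hx
      exact (hi.trans (lift (hds i y hy))).mono (by norm_num)
    · obtain ⟨i, hi⟩ := hout x hx
      obtain ⟨j, hj⟩ := hin y hy
      exact ((hi.trans (lift (hdd i j))).trans hj).mono (by norm_num)

end StarPartition

end SimpleGraph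

/-! ### Finite patterns with computable distances. -/

namespace StarPattern

/-- The digraph on the natural numbers with the listed arcs. -/
def digraph (L : List (ℕ × ℕ)) : Digraph ℕ := ⟨fun u v => (u, v) ∈ L⟩

/-- Adds to the set of naturals with bit mask `S` all heads of listed arcs with tail in `S`. -/
def step (L : List (ℕ × ℕ)) (S : ℕ) : ℕ :=
  L.foldl (fun acc p => if S.testBit p.1 then acc ||| (1 <<< p.2) else acc) S

/-- The bit mask of the set of naturals reached from the set `S` by at most `n` listed arcs. -/
def reach (L : List (ℕ × ℕ)) : ℕ → ℕ → ℕ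
  | 0, S => S
  | n + 1, S => step L (reach L n S)

theorem testBit_foldl (S : ℕ) (v : ℕ) (L : List (ℕ × ℕ)) (acc : ℕ)
    (h : (L.foldl (fun acc p => if S.testBit p.1 then acc ||| (1 <<< p.2) else acc) acc).testBit v
      = true) :
    acc.testBit v = true ∨ ∃ u, S.testBit u = true ∧ (u, v) ∈ L := by
  induction L generalizing acc with
  | nil => exact .inl h
  | cons p L ih =>
    rw [List.foldl_cons] at h
    rcases ih _ h with h | ⟨u, hu, hL⟩
    · split_ifs at h with hp
      · rw [Nat.testBit_or, Bool.or_eq_true] at h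
        rcases h with h | h
        · exact .inl h
        · right
          refine ⟨p.1, hp, ?_⟩
          have : v = p.2 := by
            rw [Nat.one_shiftLeft, Nat.testBit_two_pow] at h
            simpa [eq_comm] using h
          rw [this]
          exact List.mem_cons_self
      · exact .inl h
    · exact .inr ⟨u, hu, List.mem_cons_of_mem _ hL⟩

theorem near_of_testBit_reach (L : List (ℕ × ℕ)) (n u v : ℕ)
    (h : (reach L n (1 <<< u)).testBit v = true) : (digraph L).Near n u v := by
  induction n generalizing v with
  | zero =>
    rw [reach, Nat.one_shiftLeft, Nat.testBit_two_pow] at h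
    have : u = v := by simpa using h
    exact this ▸ .refl _ _ _
  | succ n ih =>
    rcases testBit_foldl _ _ _ _ h with h | ⟨w, hw, hL⟩
    · exact (ih v h).mono n.le_succ
    · exact (ih w hw).trans (.of_adj hL)

/-- The set with bit mask `S` contains `{0, …, n - 1}`. -/
def covers (S n : ℕ) : Bool := (List.range n).all fun v => S.testBit v

/-- The class of a node: nodes `0`, `1`, `2` are the centres, and node `k + 3` is described by
the entry `k` of the list. -/
def cls (ns : List (Fin 3 × Bool)) : ℕ → Fin 3
  | 0 => 0
  | 1 => 1
  | 2 => 2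
  | k + 3 => (ns.getD k (0, false)).1

/-- The arcs of a pattern: each node is joined to the centre of its class, with an arc out of the
centre exactly if it is marked `true`, and the list `E` contains the remaining arcs. -/
def arcs (ns : List (Fin 3 × Bool)) (E : List (ℕ × ℕ)) : List (ℕ × ℕ) :=
  (List.range ns.length).map (fun k => if (ns.getD k (0, false)).2
    then ((ns.getD k (0, false)).1.val, k + 3) else (k + 3, (ns.getD k (0, false)).1.val)) ++
  E.map fun p => (p.1 + 3, p.2 + 3)

/-- The nodes `a` and `b` lie in different classes, exactly one of them is a centre, or they are
listed in `N`. -/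
def apart (ns : List (Fin 3 × Bool)) (N : List (ℕ × ℕ)) (a b : ℕ) : Bool :=
  cls ns a != cls ns b || decide (a < 3) != decide (b < 3) ||
    (decide (3 ≤ a) && decide (3 ≤ b) && (N.contains (a - 3, b - 3) || N.contains (b - 3, a - 3)))

/-- The conditions on a pattern that make it the core of an orientation of diameter `11`. -/
def valid (ns : List (Fin 3 × Bool)) (E N : List (ℕ × ℕ)) : Bool :=
  (E.all fun p => decide (p.1 < ns.length) && decide (p.2 < ns.length)) &&
  ((arcs ns E).all fun p => (arcs ns E).all fun q =>
    apart ns N p.1 q.2 || apart ns N p.2 q.1) &&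
  ((List.range 3).all fun u => covers (reach (arcs ns E) 7 (1 <<< u)) 3 &&
    covers (reach (arcs ns E) 9 (1 <<< u)) (ns.length + 3)) &&
  ((List.range (ns.length + 3)).all fun u => covers (reach (arcs ns E) 9 (1 <<< u)) 3 &&
    covers (reach (arcs ns E) 11 (1 <<< u)) (ns.length + 3))

end StarPattern

namespace SimpleGraph.StarPartition

open StarPattern

variable {V : Type*} {G : SimpleGraph V} {d : Fin 3 → V} {f : V → Fin 3}

/-- The vertex represented by a node of a pattern. -/
def place (d : Fin 3 → V) (vs : List V) : ℕ → V
  | 0 => d 0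
  | 1 => d 1
  | 2 => d 2
  | k + 3 => vs.getD k (d 0)

theorem place_fin (d : Fin 3 → V) (vs : List V) (i : Fin 3) : place d vs i = d i := by
  fin_cases i <;> rfl

/-- A valid pattern that can be placed in `G` yields an orientation of diameter at most `11`. -/
theorem hasOrientation_of_pattern [Finite V] (S : G.StarPartition d f) (vs : List V)
    (ns : List (Fin 3 × Bool)) (E N : List (ℕ × ℕ)) (hvalid : valid ns E N = true)
    (hvs : List.Forall₂ (fun v c => f v = c.1 ∧ v ≠ d c.1) vs ns)
    (hE : ∀ p ∈ E, G.Adj (vs.getD p.1 (d 0)) (vs.getD p.2 (d 0)))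
    (hN : ∀ p ∈ N, vs.getD p.1 (d 0) ≠ vs.getD p.2 (d 0)) : G.HasOrientation 11 := by
  simp only [valid, Bool.and_eq_true, List.all_eq_true, decide_eq_true_eq, covers,
    List.mem_range] at hvalid
  obtain ⟨⟨⟨hbd, hanti⟩, hd⟩, hs⟩ := hvalid
  set L := arcs ns E with hL
  -- `φ` need not be injective. Walks map forward along it, so coincidences do not increase
  -- distances; distinctness is needed only to keep two arcs from becoming opposite, which is what
  -- `apart` controls.
  set φ := place d vs with hφ
  have hlen : vs.length = ns.length := hvs.length_eq
  have hnode : ∀ k < ns.length, f (φ (k + 3)) = (ns.getD k (0, false)).1 ∧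
      φ (k + 3) ≠ d (ns.getD k (0, false)).1 := by
    intro k hk
    have h := List.Forall₂.get hvs (i := k) (hlen ▸ hk) hk
    simpa [φ, place, List.getD_eq_getElem, hk, hlen] using h
  have hcls : ∀ k < ns.length + 3, f (φ k) = cls ns k := by
    intro k hk
    match k, hk with
    | 0, _ => exact S.class_center 0
    | 1, _ => exact S.class_center 1
    | 2, _ => exact S.class_center 2
    | k + 3, hk => exact (hnode k (by omega)).1
  have hcen : ∀ k < ns.length + 3, (φ k = d (f (φ k)) ↔ k < 3) := by
    intro k hk
    match k, hk with
    | 0, _ => simp [φ, place, S.class_center]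
    | 1, _ => simp [φ, place, S.class_center]
    | 2, _ => simp [φ, place, S.class_center]
    | k + 3, hk =>
      have := hnode k (by omega)
      rw [this.1]
      exact iff_of_false this.2 (by omega)
  have hmem : ∀ p, p ∈ L ↔ (∃ k < ns.length, p = if (ns.getD k (0, false)).2
      then ((ns.getD k (0, false)).1.val, k + 3) else (k + 3, (ns.getD k (0, false)).1.val)) ∨
      ∃ q ∈ E, p = (q.1 + 3, q.2 + 3) := by
    intro p
    simp only [L, arcs, List.mem_append, List.mem_map, List.mem_range, eq_comm]
  have hLbd : ∀ p ∈ L, p.1 < ns.length + 3 ∧ p.2 < ns.length + 3 := by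
    intro p hp
    rcases (hmem p).1 hp with ⟨k, hk, rfl⟩ | ⟨q, hq, rfl⟩
    · have := (ns.getD k (0, false)).1.isLt
      split_ifs <;> simp only <;> omega
    · have := hbd q hq
      simp only
      omega
  have happ : ∀ a < ns.length + 3, ∀ b < ns.length + 3, apart ns N a b = true → φ a ≠ φ b := by
    intro a ha b hb hab heq
    simp only [apart, Bool.or_eq_true, Bool.and_eq_true, bne_iff_ne, ne_eq, decide_eq_true_eq,
      List.contains_iff_mem, ← hcls a ha, ← hcls b hb, decide_eq_decide] at hab
    rcases hab with (hab | hab) | ⟨⟨h3a, h3b⟩, hab⟩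
    · exact hab (by rw [heq])
    · rw [← hcen a ha, ← hcen b hb, heq] at hab
      exact hab Iff.rfl
    · obtain ⟨a, rfl⟩ := Nat.exists_eq_add_of_le' h3a
      obtain ⟨b, rfl⟩ := Nat.exists_eq_add_of_le' h3b
      rcases hab with hab | hab
      · exact hN _ hab heq
      · exact hN _ hab heq.symm
  have hLadj : ∀ p ∈ L, G.Adj (φ p.1) (φ p.2) := by
    intro p hp
    rcases (hmem p).1 hp with ⟨k, hk, rfl⟩ | ⟨q, hq, rfl⟩
    · have h1 := hnode k hk
      have h2 := S.adj_center (φ (k + 3)) (by rw [h1.1]; exact h1.2)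
      rw [h1.1] at h2
      split_ifs
      · simpa [φ, place_fin] using h2
      · simpa [φ, place_fin] using h2.symm
    · exact hE q hq
  let H : Digraph V := ⟨fun u v => ∃ p ∈ L, φ p.1 = u ∧ φ p.2 = v⟩
  have hnear : ∀ {n u v}, (reach L n (1 <<< u)).testBit v = true → H.Near n (φ u) (φ v) :=
    fun h => Digraph.Near.map (K := H) φ (fun u v huv => ⟨(u, v), huv, rfl, rfl⟩)
      (near_of_testBit_reach L _ _ _ h)
  refine S.hasOrientation_of_core {v | ∃ k < ns.length + 3, φ k = v} H ?_ ?_ ?_ ?_ ?_ ?_ ?_ ?_ ?_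
  · rintro u v ⟨p, hp, rfl, rfl⟩
    exact ⟨⟨_, (hLbd p hp).1, rfl⟩, ⟨_, (hLbd p hp).2, rfl⟩⟩
  · rintro u v ⟨p, hp, rfl, rfl⟩
    exact hLadj p hp
  · rintro u v ⟨p, hp, rfl, rfl⟩ ⟨q, hq, h1, h2⟩
    have hb := hLbd p hp
    have hb' := hLbd q hq
    have := hanti p hp q hq
    rw [Bool.or_eq_true] at this
    rcases this with h | h
    · exact happ _ hb.1 _ hb'.2 h h2.symm
    · exact happ _ hb.2 _ hb'.1 h h1.symm
  · exact fun i => ⟨i, by omega, place_fin d vs i⟩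
  · rintro s ⟨k, hk, rfl⟩
    by_cases hk3 : k < 3
    · exact .inl ⟨⟨k, hk3⟩, .inl (place_fin d vs ⟨k, hk3⟩)⟩
    · obtain ⟨k, rfl⟩ := Nat.exists_eq_add_of_le' (not_lt.mp hk3)
      have hm := (hmem _).2 (.inl ⟨k, by omega, rfl⟩)
      split_ifs at hm
      · exact .inr ⟨_, _, hm, place_fin d vs _, rfl⟩
      · exact .inl ⟨_, .inr ⟨_, hm, rfl, place_fin d vs _⟩⟩
  · intro i j
    have := hnear ((hd i i.isLt).1 j j.isLt)
    rwa [hφ, place_fin, place_fin] at this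
  · rintro i s ⟨k, hk, rfl⟩
    have := hnear ((hd i i.isLt).2 k hk)
    rwa [hφ, place_fin] at this
  · rintro i s ⟨k, hk, rfl⟩
    have := hnear ((hs k hk).1 i i.isLt)
    rwa [hφ, place_fin] at this
  · rintro s ⟨k, hk, rfl⟩ t ⟨l, hl, rfl⟩
    exact hnear ((hs k hk).2 l hl)

end SimpleGraph.StarPartition

/-! ### Reduction to isolated centres by subdivision. -/

namespace SimpleGraph

variable {V : Type*}

/-- The graph obtained from `G` by subdividing the edge `u w`. -/
def subdivideEdge (G : SimpleGraph V) (u w : V) : SimpleGraph (Option V) where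
  Adj
    | some a, some b => G.Adj a b ∧ ¬ (a = u ∧ b = w) ∧ ¬ (a = w ∧ b = u)
    | some a, none => a = u ∨ a = w
    | none, some b => b = u ∨ b = w
    | none, none => False
  symm := ⟨by
    rintro (_ | a) (_ | b) h
    · exact h
    · exact h
    · exact h
    · exact ⟨h.1.symm, fun h' => h.2.2 h'.symm, fun h' => h.2.1 h'.symm⟩⟩
  loopless := ⟨by
    rintro (_ | a) h
    · exact h
    · exact G.irrefl h.1⟩

theorem TwoEdgeCuts.subdivideEdge {G : SimpleGraph V} (h : G.TwoEdgeCuts) {u w : V}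
    (huw : u ≠ w) : (G.subdivideEdge u w).TwoEdgeCuts := by
  classical
  intro X a₀ b₀ hX hX'
  set X₀ : Set V := {v | some v ∈ X} with hX₀
  by_cases h1 : X₀.Nonempty
  · by_cases h2 : X₀ᶜ.Nonempty
    · by_cases hn : none ∈ X
      · obtain ⟨a, ha, b, hb, hab, hne⟩ :=
          h X₀ (a₀.getD (if b₀.getD u = u then w else u)) (b₀.getD u) h1 h2
        by_cases he : (a = u ∧ b = w) ∨ (a = w ∧ b = u)
        · refine ⟨none, hn, some b, hb, ?_, ?_⟩
          · rcases he with ⟨-, rfl⟩ | ⟨-, rfl⟩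
            exacts [.inr rfl, .inl rfl]
          · rintro ⟨rfl, rfl⟩
            apply hne
            rcases he with ⟨rfl, rfl⟩ | ⟨rfl, rfl⟩
            · simp [huw.symm]
            · simp
        · refine ⟨some a, ha, some b, hb, ⟨hab, not_or.mp he⟩, ?_⟩
          rintro ⟨rfl, rfl⟩
          exact hne ⟨rfl, rfl⟩
      · obtain ⟨a, ha, b, hb, hab, hne⟩ :=
          h X₀ (a₀.getD u) (b₀.getD (if a₀.getD u = u then w else u)) h1 h2
        by_cases he : (a = u ∧ b = w) ∨ (a = w ∧ b = u)
        · refine ⟨some a, ha, none, hn, ?_, ?_⟩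
          · rcases he with ⟨rfl, -⟩ | ⟨rfl, -⟩
            exacts [.inl rfl, .inr rfl]
          · rintro ⟨rfl, rfl⟩
            apply hne
            rcases he with ⟨rfl, rfl⟩ | ⟨rfl, rfl⟩
            · simp
            · simp [huw.symm]
        · refine ⟨some a, ha, some b, hb, ⟨hab, not_or.mp he⟩, ?_⟩
          rintro ⟨rfl, rfl⟩
          exact hne ⟨rfl, rfl⟩
    · have hall : ∀ v, some v ∈ X := fun v => by
        by_contra hv
        exact h2 ⟨v, hv⟩
      have hn : none ∉ X := by
        obtain ⟨_ | v, hv⟩ := hX'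
        exacts [hv, (hv (hall v)).elim]
      by_cases ha : a₀ = some u
      · refine ⟨some w, hall w, none, hn, .inr rfl, ?_⟩
        rintro ⟨rfl, -⟩
        exact huw (Option.some.inj ha).symm
      · exact ⟨some u, hall u, none, hn, .inl rfl, fun h => ha h.1.symm⟩
  · have hall : ∀ v, some v ∉ X := fun v hv => h1 ⟨v, hv⟩
    have hn : none ∈ X := by
      obtain ⟨_ | v, hv⟩ := hX
      exacts [hv, (hall v hv).elim]
    by_cases hb : b₀ = some u
    · refine ⟨none, hn, some w, hall w, .inr rfl, ?_⟩
      rintro ⟨-, rfl⟩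
      exact huw (Option.some.inj hb).symm
    · exact ⟨none, hn, some u, hall u, .inl rfl, fun h => hb h.2.symm⟩

/-- Contracting a directed path through the new vertex to a single arc never lengthens a walk. If
the two half-edges do not form a directed path, no walk between old vertices uses the new vertex. -/
theorem HasOrientation.of_subdivideEdge {G : SimpleGraph V} {u w : V} (huw : G.Adj u w) {n : ℕ}
    (h : (G.subdivideEdge u w).HasOrientation n) : G.HasOrientation n := by
  obtain ⟨H, hsub, hasymm, hnear⟩ := h
  have hne := huw.ne
  let K : Digraph V := ⟨fun a b => H.Adj (some a) (some b) ∨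
    (a = u ∧ b = w ∧ H.Adj (some u) none ∧ H.Adj none (some w)) ∨
    (a = w ∧ b = u ∧ H.Adj (some w) none ∧ H.Adj none (some u))⟩
  have key : ∀ m a b, H.HasWalk (some a) (some b) m → K.Near m a b := by
    intro m
    induction m using Nat.strong_induction_on with
    | _ m ih =>
      intro a b hw
      cases hw with
      | nil => exact .refl _ _ _
      | @cons _ c _ m h1 h2 =>
        rcases c with _ | c
        · cases h2 with
          | @cons _ c _ m h2 h3 =>
            rcases c with _ | c
            · exact (hsub _ _ h2).elim
            · have hK : K.Adj a c := by
                have hac : a ≠ c := fun hac => hasymm _ _ h1 (hac ▸ h2)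
                rcases hsub _ _ h1 with rfl | rfl <;> rcases hsub _ _ h2 with rfl | rfl
                · exact (hac rfl).elim
                · exact .inr (.inl ⟨rfl, rfl, h1, h2⟩)
                · exact .inr (.inr ⟨rfl, rfl, h1, h2⟩)
                · exact (hac rfl).elim
              exact ((Digraph.Near.of_adj hK).trans (ih m (by omega) c b h3)).mono (by omega)
        · have hK : K.Adj a c := .inl h1
          exact ((Digraph.Near.of_adj hK).trans (ih m (by omega) c b h2)).mono (by omega)
  refine ⟨K, ?_, ?_, ?_⟩
  · rintro a b (h | ⟨rfl, rfl, -⟩ | ⟨rfl, rfl, -⟩)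
    exacts [(hsub _ _ h).1, huw, huw.symm]
  · rintro a b (h | ⟨rfl, rfl, h1, h2⟩ | ⟨rfl, rfl, h1, h2⟩) (h' | ⟨h3, h4, h5, h6⟩ | ⟨h3, h4, h5, h6⟩)
    · exact hasymm _ _ h h'
    · exact (hsub _ _ h).2.2 ⟨h4, h3⟩
    · exact (hsub _ _ h).2.1 ⟨h4, h3⟩
    · exact (hsub _ _ h').2.2 ⟨rfl, rfl⟩
    · exact hne h4
    · exact hasymm _ _ h1 h6
    · exact (hsub _ _ h').2.1 ⟨rfl, rfl⟩
    · exact hasymm _ _ h1 h6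
    · exact hne h3
  · intro a b
    obtain ⟨m, hm, h⟩ := hnear (some a) (some b)
    exact (key m a b h).mono hm

/-- No centre is incident with an edge that leaves its class. -/
def IsolatedCenters (G : SimpleGraph V) (d : Fin 3 → V) (f : V → Fin 3) : Prop :=
  ∀ i y, G.Adj (d i) y → f y = i

/-- The new vertex joins the class of `d i`, so the edge leaving the class now starts at a
non-centre. -/
theorem StarPartition.subdivideEdge {G : SimpleGraph V} {d : Fin 3 → V} {f : V → Fin 3}
    (S : G.StarPartition d f) {i : Fin 3} {y : V} (h : G.Adj (d i) y) (hy : f y ≠ i) :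
    (G.subdivideEdge (d i) y).StarPartition (fun j => some (d j)) (fun v => v.elim i f) where
  class_center := S.class_center
  adj_center := by
    rintro (_ | x) hx
    · exact .inl rfl
    · refine ⟨S.adj_center x fun hx' => hx (congrArg some hx'), ?_, ?_⟩
      · rintro ⟨h1, rfl⟩
        have := congrArg f h1
        rw [S.class_center, S.class_center] at this
        exact hy this
      · rintro ⟨h1, rfl⟩
        exact h.ne ((congrArg d (S.class_center i)).symm.trans h1)
  cut := S.cut.subdivideEdge h.ne

/-- Induction on the number of pairs of a centre and a neighbour outside its class; each subdivision
lowers it. -/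
theorem StarPartition.hasOrientation_of_isolatedCenters
    (hiso : ∀ (W : Type) [Finite W] (G : SimpleGraph W) (d : Fin 3 → W) (f : W → Fin 3),
      G.StarPartition d f → G.IsolatedCenters d f → G.HasOrientation 11)
    {V : Type} [Finite V] {G : SimpleGraph V} {d : Fin 3 → V} {f : V → Fin 3}
    (S : G.StarPartition d f) : G.HasOrientation 11 := by
  obtain ⟨n, hn⟩ : ∃ n, {p : Fin 3 × V | G.Adj (d p.1) p.2 ∧ f p.2 ≠ p.1}.ncard = n := ⟨_, rfl⟩
  induction n using Nat.strong_induction_on generalizing V with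
  | _ n ih =>
    by_cases hG : G.IsolatedCenters d f
    · exact hiso V G d f S hG
    · simp only [IsolatedCenters, not_forall] at hG
      obtain ⟨i, y, hadj, hy⟩ := hG
      refine HasOrientation.of_subdivideEdge hadj (ih _ ?_ (S.subdivideEdge hadj hy) rfl)
      rw [← hn]
      have hlt : {p : Fin 3 × V | G.Adj (d p.1) p.2 ∧ f p.2 ≠ p.1} \ {(i, y)} ⊂
          {p : Fin 3 × V | G.Adj (d p.1) p.2 ∧ f p.2 ≠ p.1} :=
        Set.sdiff_singleton_ssubset.2 ⟨hadj, hy⟩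
      refine lt_of_le_of_lt ?_ (Set.ncard_lt_ncard hlt (Set.toFinite _))
      -- If `y` is itself a centre, its former neighbour `d i` is replaced by `none`, so sending
      -- `none` to `d i` embeds the new pairs into the old ones without `(i, y)`.
      refine Set.ncard_le_ncard_of_injOn (fun p => (p.1, p.2.getD (d i))) ?_ ?_ (Set.toFinite _)
      · rintro ⟨j, _ | z⟩ ⟨h1, h2⟩
        · have hj : d j = y := by
            rcases h1 with h1 | h1
            · have := congrArg f h1
              rw [S.class_center, S.class_center] at this
              exact (h2 this.symm).elim
            · exact h1
          subst hj
          have hji : j ≠ i := by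
            rintro rfl
            exact hadj.ne rfl
          refine ⟨⟨hadj.symm, ?_⟩, ?_⟩
          · simpa [S.class_center] using hji.symm
          · simp [hji]
        · refine ⟨⟨h1.1, h2⟩, ?_⟩
          rintro h
          obtain ⟨rfl, rfl⟩ := Prod.mk.inj h
          exact h1.2.1 ⟨rfl, rfl⟩
      · have aux : ∀ j, f (d i) ≠ j → ¬ (G.subdivideEdge (d i) y).Adj (some (d j)) none ∨
            ¬ (G.subdivideEdge (d i) y).Adj (some (d j)) (some (d i)) := by
          intro j hj
          rw [← not_and_or]
          rintro ⟨h1 | h1, h2⟩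
          · exact h2.1.ne h1
          · exact h2.2.2 ⟨h1, rfl⟩
        rintro ⟨j, _ | z⟩ ⟨h1, h2⟩ ⟨j', _ | z'⟩ ⟨h1', h2'⟩ h
        · simpa using h
        · obtain ⟨rfl, rfl⟩ : j = j' ∧ d i = z' := by simpa using h
          exact ((aux j h2').elim (· h1) (· h1')).elim
        · obtain ⟨rfl, rfl⟩ : j = j' ∧ z = d i := by simpa using h
          exact ((aux j h2).elim (· h1') (· h1)).elim
        · simpa using h

end SimpleGraph

/-! ### Links, and the case where every two classes are linked. -/

namespace SimpleGraph

variable {V : Type*} {G : SimpleGraph V} {d : Fin 3 → V} {f : V → Fin 3}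

/-- `v` lies in the class `i` and is not its centre. -/
def IsInner (d : Fin 3 → V) (f : V → Fin 3) (i : Fin 3) (v : V) : Prop := f v = i ∧ v ≠ d i

/-- `a b` is an edge between inner vertices of the classes `i` and `j`. -/
def IsLink (G : SimpleGraph V) (d : Fin 3 → V) (f : V → Fin 3) (i j : Fin 3) (a b : V) : Prop :=
  IsInner d f i a ∧ IsInner d f j b ∧ G.Adj a b

theorem IsLink.symm {i j : Fin 3} {a b : V} (h : G.IsLink d f i j a b) : G.IsLink d f j i b a :=
  ⟨h.2.1, h.1, h.2.2.symm⟩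

theorem IsolatedCenters.isLink (I : G.IsolatedCenters d f) {a b : V} (hab : G.Adj a b)
    (hne : f b ≠ f a) : G.IsLink d f (f a) (f b) a b := by
  refine ⟨⟨rfl, fun h => ?_⟩, ⟨rfl, fun h => ?_⟩, hab⟩
  · exact hne (I (f a) b (h ▸ hab))
  · exact hne (I (f b) a (h ▸ hab.symm)).symm

namespace StarPartition

open StarPattern

theorem permute (S : G.StarPartition d f) (σ : Equiv.Perm (Fin 3)) :
    G.StarPartition (d ∘ σ) (σ.symm ∘ f) where
  class_center i := by simp [S.class_center]
  adj_center x hx := by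
    simp only [Function.comp_apply, Equiv.apply_symm_apply] at hx ⊢
    exact S.adj_center x hx
  cut := S.cut

/-- A version of `hasOrientation_of_pattern` in which the classes are renumbered. -/
theorem hasOrientation_of_pattern_perm [Finite V] (S : G.StarPartition d f) {i j k : Fin 3}
    (hij : i ≠ j) (hik : i ≠ k) (hjk : j ≠ k) (vs : List V)
    (ns : List (Fin 3 × Bool)) (E N : List (ℕ × ℕ)) (hvalid : valid ns E N = true)
    (hvs : List.Forall₂ (fun v c => IsInner d f (![i, j, k] c.1) v) vs ns)
    (hE : ∀ p ∈ E, G.Adj (vs.getD p.1 (d i)) (vs.getD p.2 (d i)))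
    (hN : ∀ p ∈ N, vs.getD p.1 (d i) ≠ vs.getD p.2 (d i)) : G.HasOrientation 11 := by
  have hinj : Function.Injective ![i, j, k] := by
    intro a b
    fin_cases a <;> fin_cases b <;> simp [hij, hik, hjk, hij.symm, hik.symm, hjk.symm]
  let σ : Equiv.Perm (Fin 3) := Equiv.ofBijective _ (Finite.injective_iff_bijective.1 hinj)
  refine (S.permute σ).hasOrientation_of_pattern vs ns E N hvalid (hvs.imp ?_) hE hN
  rintro v c ⟨h1, h2⟩
  exact ⟨by rw [Function.comp_apply, Equiv.symm_apply_eq]; exact h1, h2⟩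

/-- Either the inner vertex `p` has a neighbour among the inner vertices of its own class, or
another vertex of the class is incident with a link. -/
theorem exists_inner_adj_or_link (S : G.StarPartition d f) (I : G.IsolatedCenters d f) {i : Fin 3}
    {p : V} (hp : IsInner d f i p) : (∃ t, IsInner d f i t ∧ G.Adj p t) ∨
      ∃ r t, r ≠ p ∧ f t ≠ i ∧ G.IsLink d f i (f t) r t := by
  -- The cut separates `p` and the other classes from the rest of its class, and the excluded edge
  -- is the spoke at `p`.
  obtain ⟨a, ⟨rfl, hap⟩, b, hb, hab, hne⟩ := S.cut {v | f v = i ∧ v ≠ p} (d i) p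
    ⟨d i, S.class_center i, hp.2.symm⟩ ⟨p, fun h => h.2 rfl⟩
  by_cases hfb : f b = f a
  · have hbp : b = p := by
      by_contra h
      exact hb ⟨hfb, h⟩
    subst hbp
    exact .inl ⟨a, ⟨rfl, fun h => hne ⟨h, rfl⟩⟩, hab.symm⟩
  · exact .inr ⟨a, b, hap, hfb, I.isLink hab hfb⟩

section Triangle

variable {i j k : Fin 3}

/-- Links between each two of the classes, where each class contains two endpoints of them or a
triangle at the common endpoint. -/
theorem hasOrientation_of_triangle [Finite V] (S : G.StarPartition d f) (hij : i ≠ j) (hik : i ≠ k)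
    (hjk : j ≠ k) {xij xik xji xjk xki xkj : V} (h1 : G.IsLink d f i j xij xji)
    (h2 : G.IsLink d f j k xjk xkj) (h3 : G.IsLink d f k i xki xik)
    (hi : xij ≠ xik ∨ ∃ t, IsInner d f i t ∧ G.Adj xij t)
    (hj : xji ≠ xjk ∨ ∃ t, IsInner d f j t ∧ G.Adj xji t)
    (hk : xki ≠ xkj ∨ ∃ t, IsInner d f k t ∧ G.Adj xki t) : G.HasOrientation 11 := by
  obtain ⟨a1, a2, a3⟩ := h1
  obtain ⟨b1, b2, b3⟩ := h2
  obtain ⟨c1, c2, c3⟩ := h3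
  -- With all ends distinct the core is a directed 9-cycle through the centres and the three links.
  -- Where the ends in a class coincide, the cycle bypasses the centre, which is joined to it by the
  -- directed triangle from the centre to the common end, then `t` (or `u`, `v`), and back.
  by_cases ei : xij = xik <;> by_cases ej : xji = xjk <;> by_cases ek : xki = xkj
  · obtain ⟨t, ht, htt⟩ := hi.resolve_left (· ei)
    obtain ⟨u, hu, huu⟩ := hj.resolve_left (· ej)
    obtain ⟨v, hv, hvv⟩ := hk.resolve_left (· ek)
    subst ei ej ek
    exact S.hasOrientation_of_pattern_perm hij hik hjk [xij, t, xji, u, xki, v]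
      [(0, true), (0, false), (1, true), (1, false), (2, true), (2, false)]
      [(0, 1), (2, 3), (4, 5), (0, 2), (2, 4), (4, 0)] [(0, 1), (2, 3), (4, 5)]
      (by decide) (by simp [*]) (by simp [*]) (by simp [htt.ne, huu.ne, hvv.ne])
  · obtain ⟨t, ht, htt⟩ := hi.resolve_left (· ei)
    obtain ⟨u, hu, huu⟩ := hj.resolve_left (· ej)
    subst ei ej
    exact S.hasOrientation_of_pattern_perm hij hik hjk [xij, t, xji, u, xki, xkj]
      [(0, true), (0, false), (1, true), (1, false), (2, true), (2, false)]
      [(0, 1), (2, 3), (0, 2), (2, 5), (4, 0)] [(0, 1), (2, 3), (4, 5)]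
      (by decide) (by simp [*]) (by simp [*]) (by simp [htt.ne, huu.ne, ek])
  · obtain ⟨t, ht, htt⟩ := hi.resolve_left (· ei)
    obtain ⟨v, hv, hvv⟩ := hk.resolve_left (· ek)
    subst ei ek
    exact S.hasOrientation_of_pattern_perm hij hik hjk [xij, t, xjk, xji, xki, v]
      [(0, true), (0, false), (1, true), (1, false), (2, true), (2, false)]
      [(0, 1), (4, 5), (0, 3), (2, 4), (4, 0)] [(0, 1), (3, 2), (4, 5)]
      (by decide) (by simp [*]) (by simp [*]) (by simp [htt.ne, hvv.ne, ej])
  · obtain ⟨t, ht, htt⟩ := hi.resolve_left (· ei)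
    subst ei
    exact S.hasOrientation_of_pattern_perm hij hik hjk [xij, t, xjk, xji, xki, xkj]
      [(0, true), (0, false), (1, true), (1, false), (2, true), (2, false)]
      [(0, 1), (0, 3), (2, 5), (4, 0)] [(0, 1), (3, 2), (4, 5)]
      (by decide) (by simp [*]) (by simp [*]) (by simp [htt.ne, ek, ej])
  · obtain ⟨u, hu, huu⟩ := hj.resolve_left (· ej)
    obtain ⟨v, hv, hvv⟩ := hk.resolve_left (· ek)
    subst ej ek
    exact S.hasOrientation_of_pattern_perm hij hik hjk [xij, xik, xji, u, xki, v]
      [(0, true), (0, false), (1, true), (1, false), (2, true), (2, false)]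
      [(2, 3), (4, 5), (0, 2), (2, 4), (4, 1)] [(0, 1), (2, 3), (4, 5)]
      (by decide) (by simp [*]) (by simp [*]) (by simp [ei, huu.ne, hvv.ne])
  · obtain ⟨u, hu, huu⟩ := hj.resolve_left (· ej)
    subst ej
    exact S.hasOrientation_of_pattern_perm hij hik hjk [xij, xik, xji, u, xki, xkj]
      [(0, true), (0, false), (1, true), (1, false), (2, true), (2, false)]
      [(2, 3), (0, 2), (2, 5), (4, 1)] [(0, 1), (2, 3), (4, 5)]
      (by decide) (by simp [*]) (by simp [*]) (by simp [ei, huu.ne, ek])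
  · obtain ⟨v, hv, hvv⟩ := hk.resolve_left (· ek)
    subst ek
    exact S.hasOrientation_of_pattern_perm hij hik hjk [xij, xik, xjk, xji, xki, v]
      [(0, true), (0, false), (1, true), (1, false), (2, true), (2, false)]
      [(4, 5), (0, 3), (2, 4), (4, 1)] [(0, 1), (3, 2), (4, 5)]
      (by decide) (by simp [*]) (by simp [*]) (by simp [ei, ej, hvv.ne])
  · exact S.hasOrientation_of_pattern_perm hij hik hjk [xij, xik, xjk, xji, xki, xkj]
      [(0, true), (0, false), (1, true), (1, false), (2, true), (2, false)]
      [(0, 3), (2, 5), (4, 1)] [(0, 1), (3, 2), (4, 5)]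
      (by decide) (by simp [*]) (by simp [*]) (by simp [ei, ej, ek])

/-- The number of classes in which the ends of the given links agree. -/
noncomputable def sharedCount (xij xik xji xjk xki xkj : V) : ℕ :=
  open Classical in
  (if xij = xik then 1 else 0) + (if xji = xjk then 1 else 0) + (if xki = xkj then 1 else 0)

/-- All systems of links between each two of the classes have at least `n` classes in which the
ends of the links agree. -/
def MinShared (G : SimpleGraph V) (d : Fin 3 → V) (f : V → Fin 3) (n : ℕ) : Prop :=
  ∀ (i j k : Fin 3) (xij xik xji xjk xki xkj : V), i ≠ j → i ≠ k → j ≠ k →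
    G.IsLink d f i j xij xji → G.IsLink d f j k xjk xkj → G.IsLink d f k i xki xik →
    n ≤ sharedCount xij xik xji xjk xki xkj

/-- Exchanging the link at `p` for `r t` separates the ends in class `i`; by minimality the ends in
class `j` must then coincide, so `t = xjk` and `xji ≠ xjk`. The core is the 6-cycle `d i`, `r`, `t`,
`d j`, `xji`, `p`, with a connection from `t` to `p` via class `k`. -/
theorem hasOrientation_of_parallel_link [Finite V] (S : G.StarPartition d f)
    (I : G.IsolatedCenters d f)
    (hij : i ≠ j) (hik : i ≠ k) (hjk : j ≠ k) {p xji xjk xki xkj r t : V} {n : ℕ}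
    (hmin : MinShared G d f n) (h1 : G.IsLink d f i j p xji)
    (h2 : G.IsLink d f j k xjk xkj) (h3 : G.IsLink d f k i xki p)
    (hn : sharedCount p p xji xjk xki xkj ≤ n) (hrt : G.IsLink d f i j r t) (hrp : r ≠ p) :
    G.HasOrientation 11 := by
  have hm := hn.trans (hmin i j k r p t xjk xki xkj hij hik hjk hrt h2 h3)
  obtain ⟨rfl, hne⟩ : t = xjk ∧ xji ≠ xjk := by
    simp only [sharedCount, if_neg hrp] at hm
    constructor
    · by_contra h
      simp [h] at hm
    · rintro rfl
      simp only [if_true] at hm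
      split_ifs at hm <;> omega
  by_cases hk : xki = xkj
  · subst hk
    rcases S.exists_inner_adj_or_link I h3.1 with ⟨u, hu, hadj⟩ | ⟨a, b, hab, hbk, hlink⟩
    · exact S.hasOrientation_of_pattern_perm hij hik hjk [p, r, xji, t, xki, u]
        [(0, false), (0, true), (1, true), (1, false), (2, false), (2, true)]
        [(1, 3), (2, 0), (3, 4), (4, 0), (5, 4)] [(0, 1), (2, 3), (4, 5)] (by decide)
        (by simp [h1.1, hrt.1, h1.2.1, hrt.2.1, h3.1, hu])
        (by simp [hrt.2.2, h1.2.2.symm, h2.2.2, h3.2.2, hadj.symm])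
        (by simp [hrp.symm, hne, hadj.ne])
    -- The given system has two classes with coincident ends. A link at `a ≠ xki`, together with the
    -- exchange to `r t` when it goes to class `j`, would leave at most one.
    · exfalso
      have hb : f b = i ∨ f b = j := by
        revert hbk
        generalize f b = l
        clear hlink hmin hn hm hrt h1 h2 h3
        revert i j k l
        decide
      rcases hb with hb | hb <;> rw [hb] at hlink
      · have := hn.trans (hmin i j k p b xji t a xki hij hik hjk h1 h2 hlink)
        simp only [sharedCount, if_true, if_neg hne, if_neg hab] at this
        split_ifs at this <;> omega
      · have := hn.trans (hmin i j k r p t b xki a hij hik hjk hrt hlink.symm h3)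
        simp only [sharedCount, if_true, if_neg hne, if_neg hab.symm, if_neg hrp] at this
        split_ifs at this <;> omega
  · exact S.hasOrientation_of_pattern_perm hij hik hjk [p, r, xji, t, xkj, xki]
      [(0, false), (0, true), (1, true), (1, false), (2, false), (2, true)]
      [(1, 3), (2, 0), (3, 4), (5, 0)] [(0, 1), (2, 3), (4, 5)] (by decide)
      (by simp [h1.1, hrt.1, h1.2.1, hrt.2.1, h3.1, h2.2.1])
      (by simp [hrt.2.2, h1.2.2.symm, h2.2.2, h3.2.2])
      (by simp [hrp.symm, hne, Ne.symm hk])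

theorem hasOrientation_of_shared [Finite V] (S : G.StarPartition d f) (I : G.IsolatedCenters d f)
    (hij : i ≠ j) (hik : i ≠ k) (hjk : j ≠ k) {p xji xjk xki xkj : V} {n : ℕ}
    (hmin : MinShared G d f n) (h1 : G.IsLink d f i j p xji)
    (h2 : G.IsLink d f j k xjk xkj) (h3 : G.IsLink d f k i xki p)
    (hn : sharedCount p p xji xjk xki xkj ≤ n)
    (ht : ¬ ∃ t, IsInner d f i t ∧ G.Adj p t) : G.HasOrientation 11 := by
  obtain ⟨r, t, hrp, hti, hrt⟩ := (S.exists_inner_adj_or_link I h1.1).resolve_left ht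
  have hf : f t = j ∨ f t = k := by
    revert hti
    generalize f t = l
    clear hrt hmin hn h1 h2 h3 ht
    revert i j k l
    decide
  rcases hf with hf | hf <;> rw [hf] at hrt
  · exact S.hasOrientation_of_parallel_link I hij hik hjk hmin h1 h2 h3 hn hrt hrp
  · refine S.hasOrientation_of_parallel_link I hik hij hjk.symm hmin h3.symm h2.symm h1.symm ?_ hrt
      hrp
    simp only [sharedCount] at hn ⊢
    omega

/-- In a system with the fewest coincidences, a coincident end without a triangle at its centre
forces a parallel link from another vertex of the class. -/
theorem hasOrientation_of_links [Finite V] (S : G.StarPartition d f) (I : G.IsolatedCenters d f)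
    (h01 : ∃ a b, G.IsLink d f 0 1 a b) (h12 : ∃ a b, G.IsLink d f 1 2 a b)
    (h20 : ∃ a b, G.IsLink d f 2 0 a b) : G.HasOrientation 11 := by
  classical
  have hex : ∃ n, ∃ (i j k : Fin 3) (xij xik xji xjk xki xkj : V), i ≠ j ∧ i ≠ k ∧ j ≠ k ∧
      G.IsLink d f i j xij xji ∧ G.IsLink d f j k xjk xkj ∧ G.IsLink d f k i xki xik ∧
      sharedCount xij xik xji xjk xki xkj = n := by
    obtain ⟨a, b, h01⟩ := h01
    obtain ⟨a', b', h12⟩ := h12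
    obtain ⟨a'', b'', h20⟩ := h20
    exact ⟨_, 0, 1, 2, _, _, _, _, _, _, by decide, by decide, by decide, h01, h12, h20, rfl⟩
  obtain ⟨i, j, k, xij, xik, xji, xjk, xki, xkj, hij, hik, hjk, h1, h2, h3, hn⟩ := Nat.find_spec hex
  have hmin : MinShared G d f (Nat.find hex) := fun i j k a b c d' e f' hij hik hjk h1 h2 h3 =>
    Nat.find_min' hex ⟨i, j, k, a, b, c, d', e, f', hij, hik, hjk, h1, h2, h3, rfl⟩
  by_cases hi : xij ≠ xik ∨ ∃ t, IsInner d f i t ∧ G.Adj xij t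
  · by_cases hj : xji ≠ xjk ∨ ∃ t, IsInner d f j t ∧ G.Adj xji t
    · by_cases hk : xki ≠ xkj ∨ ∃ t, IsInner d f k t ∧ G.Adj xki t
      · exact S.hasOrientation_of_triangle hij hik hjk h1 h2 h3 hi hj hk
      · obtain ⟨hk, ht⟩ := not_or.mp hk
        obtain rfl := not_not.mp hk
        refine S.hasOrientation_of_shared I hik.symm hjk.symm hij hmin h3 h1 h2 ?_ ht
        rw [← hn]
        simp only [sharedCount, eq_comm (a := xik) (b := xij), eq_comm (a := xjk) (b := xji)]
        omega
    · obtain ⟨hj, ht⟩ := not_or.mp hj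
      obtain rfl := not_not.mp hj
      refine S.hasOrientation_of_shared I hjk hij.symm hik.symm hmin h2 h3 h1 ?_ ht
      rw [← hn]
      simp only [sharedCount, eq_comm (a := xkj) (b := xki)]
      omega
  · obtain ⟨hi, ht⟩ := not_or.mp hi
    obtain rfl := not_not.mp hi
    exact S.hasOrientation_of_shared I hij hik hjk hmin h1 h2 h3 hn.le ht

end Triangle

end StarPartition

end SimpleGraph

/-! ### The case where two classes are linked only to the third. -/

namespace SimpleGraph

variable {V : Type*} {G : SimpleGraph V} {d : Fin 3 → V} {f : V → Fin 3}

/-- The class `i` is attached to the class `m` by links at two distinct vertices `w` and `W`,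
with either distinct ends in `i` or a triangle at the common end. -/
def IsSplitEnd (G : SimpleGraph V) (d : Fin 3 → V) (f : V → Fin 3) (i m : Fin 3) (w W : V) : Prop :=
  w ≠ W ∧ ((∃ x X, x ≠ X ∧ G.IsLink d f m i w x ∧ G.IsLink d f m i W X) ∨
    ∃ x t, G.IsLink d f m i w x ∧ G.IsLink d f m i W x ∧ IsInner d f i t ∧ G.Adj x t)

/-- The class `i` is attached to the class `m` by two links at `w`. -/
def IsPortEnd (G : SimpleGraph V) (d : Fin 3 → V) (f : V → Fin 3) (i m : Fin 3) (w : V) : Prop :=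
  ∃ x X, x ≠ X ∧ G.IsLink d f m i w x ∧ G.IsLink d f m i w X

theorem IsSplitEnd.symm {i m : Fin 3} {w W : V} (h : G.IsSplitEnd d f i m w W) :
    G.IsSplitEnd d f i m W w := by
  obtain ⟨hne, ⟨x, X, hxX, h1, h2⟩ | ⟨x, t, h1, h2, h3⟩⟩ := h
  · exact ⟨hne.symm, .inl ⟨X, x, hxX.symm, h2, h1⟩⟩
  · exact ⟨hne.symm, .inr ⟨x, t, h2, h1, h3⟩⟩

namespace StarPartition

variable {i m k : Fin 3}

/-- Closed walks from `d m` leave through `w` and return through `W` for class `i`, and use `v` and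
`U` for class `k`. The cases `w = v` and `W = U` are harmless; only a vertex needed both to leave
and to return would receive opposite spokes. -/
theorem hasOrientation_of_split_split_aligned [Finite V] (S : G.StarPartition d f) (him : i ≠ m)
    (hik : i ≠ k) (hmk : m ≠ k) {w W v U : V} (h : G.IsSplitEnd d f i m w W)
    (h' : G.IsSplitEnd d f k m v U) (hwU : w ≠ U) (hvW : v ≠ W) : G.HasOrientation 11 := by
  obtain ⟨hwW, ⟨x, X, hx, ⟨a1, a2, a3⟩, ⟨b1, b2, b3⟩⟩ |
    ⟨x, t, ⟨a1, a2, a3⟩, ⟨b1, b2, b3⟩, ht, hxt⟩⟩ := h <;>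
  obtain ⟨hvU, ⟨z, Z, hz, ⟨c1, c2, c3⟩, ⟨e1, e2, e3⟩⟩ |
    ⟨z, y, ⟨c1, c2, c3⟩, ⟨e1, e2, e3⟩, hy, hzy⟩⟩ := h'
  · exact S.hasOrientation_of_pattern_perm him hik hmk [x, X, w, W, v, U, z, Z]
      [(0, false), (0, true), (1, true), (1, false), (1, true), (1, false), (2, false), (2, true)]
      [(2, 0), (1, 3), (4, 6), (7, 5)] [(0, 1), (6, 7), (2, 3), (4, 5), (2, 5), (4, 3)]
      (by decide) (by simp [*]) (by simp [*, b3.symm, e3.symm]) (by simp [*])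
  · exact S.hasOrientation_of_pattern_perm him hik hmk [x, X, w, W, v, U, z, y]
      [(0, false), (0, true), (1, true), (1, false), (1, true), (1, false), (2, true), (2, false)]
      [(2, 0), (1, 3), (4, 6), (6, 7), (6, 5)] [(0, 1), (6, 7), (2, 3), (4, 5), (2, 5), (4, 3)]
      (by decide) (by simp [*]) (by simp [*, b3.symm, e3.symm]) (by simp [*, hzy.ne])
  · exact S.hasOrientation_of_pattern_perm hmk.symm hik.symm him.symm [z, Z, v, U, w, W, x, t]
      [(0, false), (0, true), (1, true), (1, false), (1, true), (1, false), (2, true), (2, false)]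
      [(2, 0), (1, 3), (4, 6), (6, 7), (6, 5)] [(0, 1), (6, 7), (2, 3), (4, 5), (2, 5), (4, 3)]
      (by decide) (by simp [*]) (by simp [*, b3.symm, e3.symm]) (by simp [*, hxt.ne])
  · exact S.hasOrientation_of_pattern_perm him hik hmk [x, t, w, W, v, U, z, y]
      [(0, true), (0, false), (1, true), (1, false), (1, true), (1, false), (2, true), (2, false)]
      [(2, 0), (0, 1), (0, 3), (4, 6), (6, 5), (6, 7)]
      [(0, 1), (6, 7), (2, 3), (4, 5), (2, 5), (4, 3)]
      (by decide) (by simp [*]) (by simp [*, b3.symm, e3.symm]) (by simp [*, hxt.ne, hzy.ne])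

/-- In case of a conflict, exchanging the roles of `w` and `W` removes it. -/
theorem hasOrientation_of_split_split [Finite V] (S : G.StarPartition d f) (him : i ≠ m)
    (hik : i ≠ k) (hmk : m ≠ k) {w W v U : V} (h : G.IsSplitEnd d f i m w W)
    (h' : G.IsSplitEnd d f k m v U) : G.HasOrientation 11 := by
  by_cases hwU : w = U
  · subst hwU
    exact S.hasOrientation_of_split_split_aligned him hik hmk h.symm h' h.1.symm h'.1
  · by_cases hvW : v = W
    · subst hvW
      exact S.hasOrientation_of_split_split_aligned him hik hmk h.symm h' h'.1 h.1.symm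
    · exact S.hasOrientation_of_split_split_aligned him hik hmk h h' hwU hvW

/-- Class `k` hangs on a closed walk at `U`, and the triangle of `d m`, `v`, `U` joins that walk to
the centre in both directions. -/
theorem hasOrientation_of_split_port_aligned [Finite V] (S : G.StarPartition d f) (him : i ≠ m)
    (hik : i ≠ k) (hmk : m ≠ k) {w W v U : V} (h : G.IsSplitEnd d f i m w W)
    (h' : G.IsPortEnd d f k m U) (hv : IsInner d f m v) (hvU : G.Adj v U)
    (hwU : w ≠ U) (hvW : v ≠ W) : G.HasOrientation 11 := by
  obtain ⟨z, Z, hz, ⟨c1, c2, c3⟩, ⟨-, e2, e3⟩⟩ := h'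
  obtain ⟨hwW, ⟨x, X, hx, ⟨a1, a2, a3⟩, ⟨b1, b2, b3⟩⟩ |
    ⟨x, t, ⟨a1, a2, a3⟩, ⟨b1, b2, b3⟩, ht, hxt⟩⟩ := h
  · exact S.hasOrientation_of_pattern_perm him hik hmk [x, X, w, W, v, U, z, Z]
      [(0, false), (0, true), (1, true), (1, false), (1, true), (1, false), (2, false), (2, true)]
      [(2, 0), (1, 3), (4, 5), (5, 6), (7, 5)] [(0, 1), (6, 7), (2, 3), (4, 5), (2, 5), (4, 3)]
      (by decide) (by simp [*]) (by simp [*, b3.symm, e3.symm]) (by simp [*, hvU.ne])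
  · exact S.hasOrientation_of_pattern_perm him hik hmk [x, t, w, W, v, U, z, Z]
      [(0, true), (0, false), (1, true), (1, false), (1, true), (1, false), (2, false), (2, true)]
      [(2, 0), (0, 1), (0, 3), (4, 5), (5, 6), (7, 5)]
      [(0, 1), (6, 7), (2, 3), (4, 5), (2, 5), (4, 3)]
      (by decide) (by simp [*]) (by simp [*, b3.symm, e3.symm]) (by simp [*, hvU.ne, hxt.ne])

theorem hasOrientation_of_split_port [Finite V] (S : G.StarPartition d f) (him : i ≠ m)
    (hik : i ≠ k) (hmk : m ≠ k) {w W v U : V} (h : G.IsSplitEnd d f i m w W)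
    (h' : G.IsPortEnd d f k m U) (hv : IsInner d f m v) (hvU : G.Adj v U) :
    G.HasOrientation 11 := by
  by_cases hwU : w = U
  · subst hwU
    exact S.hasOrientation_of_split_port_aligned him hik hmk h.symm h' hv hvU h.1.symm hvU.ne
  · by_cases hvW : v = W
    · subst hvW
      exact S.hasOrientation_of_split_port_aligned him hik hmk h.symm h' hv hvU hvU.ne h.1.symm
    · exact S.hasOrientation_of_split_port_aligned him hik hmk h h' hv hvU hwU hvW

theorem hasOrientation_of_port_port [Finite V] (S : G.StarPartition d f) (him : i ≠ m)
    (hik : i ≠ k) (hmk : m ≠ k) {w W v U : V} (h : G.IsPortEnd d f i m W)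
    (hw : IsInner d f m w) (hwW : G.Adj w W) (h' : G.IsPortEnd d f k m U)
    (hv : IsInner d f m v) (hvU : G.Adj v U) : G.HasOrientation 11 := by
  obtain ⟨x, X, hx, ⟨a1, a2, a3⟩, ⟨-, b2, b3⟩⟩ := h
  obtain ⟨z, Z, hz, ⟨c1, c2, c3⟩, ⟨-, e2, e3⟩⟩ := h'
  by_cases hWU : W = U
  · subst hWU
    exact S.hasOrientation_of_pattern_perm him hik hmk [x, X, w, W, z, Z]
      [(0, false), (0, true), (1, true), (1, false), (2, false), (2, true)]
      [(2, 3), (3, 0), (1, 3), (3, 4), (5, 3)] [(0, 1), (2, 3), (4, 5)]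
      (by decide) (by simp [*]) (by simp [*, b3.symm, e3.symm]) (by simp [*, hwW.ne])
  -- If the ports are adjacent, one triangle at `d m` serves both. If not, neither port is the
  -- auxiliary vertex of the other, so both triangles can be oriented without conflict, even if `w =
  -- v`.
  · by_cases hadj : G.Adj U W
    · exact S.hasOrientation_of_pattern_perm him hik hmk [x, X, U, W, z, Z]
        [(0, false), (0, true), (1, true), (1, false), (2, false), (2, true)]
        [(2, 3), (3, 0), (1, 3), (2, 4), (5, 2)] [(0, 1), (2, 3), (4, 5)]
        (by decide) (by simp [*]) (by simp [*, b3.symm, e3.symm]) (by simp [*, hadj.ne])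
    · have hwU : w ≠ U := by
        rintro rfl
        exact hadj hwW
      have hvW : v ≠ W := by
        rintro rfl
        exact hadj hvU.symm
      exact S.hasOrientation_of_pattern_perm him hik hmk [x, X, w, W, v, U, z, Z]
        [(0, false), (0, true), (1, true), (1, false), (1, true), (1, false), (2, false), (2, true)]
        [(2, 3), (3, 0), (1, 3), (4, 5), (5, 6), (7, 5)]
        [(0, 1), (6, 7), (2, 3), (4, 5), (2, 5), (4, 3)]
        (by decide) (by simp [*]) (by simp [*, b3.symm, e3.symm]) (by simp [*, hwW.ne, hvU.ne])

theorem fin_three_eq_or {a b c l : Fin 3} (hab : a ≠ b) (hac : a ≠ c) (hbc : b ≠ c) (hl : l ≠ a) :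
    l = b ∨ l = c := by
  omega

/-- If the class `i` is only linked to the class `m`, then it is attached to `m` in one of two
ways. -/
theorem exists_splitEnd_or_portEnd (S : G.StarPartition d f) (I : G.IsolatedCenters d f)
    (him : i ≠ m) (hik : i ≠ k) (hmk : m ≠ k) (hno : ∀ a b, ¬ G.IsLink d f i k a b) :
    (∃ w W, G.IsSplitEnd d f i m w W) ∨
      ∃ w, G.IsPortEnd d f i m w ∧ ∀ a b, G.IsLink d f i m a b → b = w := by
  have hcut : ∀ a₀ b₀, ∃ a b, G.IsLink d f i m a b ∧ ¬ (a = a₀ ∧ b = b₀) := by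
    intro a₀ b₀
    obtain ⟨a, rfl, b, hb, hab, hne⟩ := S.cut {v | f v = i} a₀ b₀ ⟨d i, S.class_center i⟩
      ⟨d m, fun h => him ((S.class_center m).symm.trans h).symm⟩
    have hl := I.isLink hab hb
    rcases fin_three_eq_or him hik hmk hb with h | h <;> rw [h] at hl
    · exact ⟨a, b, hl, hne⟩
    · exact (hno _ _ hl).elim
  by_cases hM : ∃ x X w W, G.IsLink d f i m x w ∧ G.IsLink d f i m X W ∧ x ≠ X ∧ w ≠ W
  -- Two disjoint links give a split end. Otherwise any two links meet: at a common end in `i`,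
  -- where the cut at that vertex supplies a triangle, or at a common end in `m`, which then lies on
  -- every link.
  · obtain ⟨x, X, w, W, h1, h2, h3, h4⟩ := hM
    exact .inl ⟨w, W, h4, .inl ⟨x, X, h3, h1.symm, h2.symm⟩⟩
  · have hM' : ∀ x X w W, G.IsLink d f i m x w → G.IsLink d f i m X W → x = X ∨ w = W := by
      intro x X w W h1 h2
      by_contra h
      exact hM ⟨x, X, w, W, h1, h2, not_or.mp h⟩
    obtain ⟨x, w, h1, -⟩ := hcut (d i) (d i)
    obtain ⟨X, W, h2, hne⟩ := hcut x w
    by_cases hxX : X = x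
    · subst hxX
      have hW : w ≠ W := fun h => hne ⟨rfl, h.symm⟩
      rcases S.exists_inner_adj_or_link I h1.1 with ⟨t, ht, hadj⟩ | ⟨r, t, hr, ht, hl⟩
      · exact .inl ⟨w, W, hW, .inr ⟨X, t, h1.symm, h2.symm, ht, hadj⟩⟩
      · rcases fin_three_eq_or him hik hmk ht with h | h <;> rw [h] at hl
        · have e1 := (hM' _ _ _ _ h1 hl).resolve_left hr.symm
          have e2 := (hM' _ _ _ _ h2 hl).resolve_left hr.symm
          exact (hW (e1.trans e2.symm)).elim
        · exact (hno _ _ hl).elim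
    · have hW := (hM' _ _ _ _ h2 h1).resolve_left hxX
      subst hW
      refine .inr ⟨W, ⟨x, X, Ne.symm hxX, h1.symm, h2.symm⟩, fun a b hab => ?_⟩
      by_contra hb
      have e1 := (hM' _ _ _ _ hab h1).resolve_right hb
      have e2 := (hM' _ _ _ _ hab h2).resolve_right hb
      exact hxX (e2.symm.trans e1)

/-- A class attached at a single vertex `w` of the class `m` that lies in no triangle of `m`. -/
theorem hasOrientation_of_port_of_not_adj [Finite V] (S : G.StarPartition d f)
    (I : G.IsolatedCenters d f) (him : i ≠ m) (hik : i ≠ k) (hmk : m ≠ k)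
    (hno : ∀ a b, ¬ G.IsLink d f i k a b) {w : V} (h : G.IsPortEnd d f i m w)
    (hw : ∀ a b, G.IsLink d f i m a b → b = w) (ht : ¬ ∃ t, IsInner d f m t ∧ G.Adj w t) :
    G.HasOrientation 11 := by
  obtain ⟨x, X, hx, ⟨a1, a2, a3⟩, ⟨-, b2, b3⟩⟩ := h
  -- Besides the spoke at `w`, another edge leaves class `i` together with `w`. Without a triangle
  -- at `w` it must start at `w` and end in class `k`.
  obtain ⟨z, hz⟩ : ∃ z, G.IsLink d f m k w z := by
    obtain ⟨a, ha, b, hb, hab, hne⟩ := S.cut {v | f v = i ∨ v = w} w (d m)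
      ⟨d i, .inl (S.class_center i)⟩
      ⟨d m, by rintro (h | h); exacts [him ((S.class_center m).symm.trans h).symm, a1.2 h.symm]⟩
    simp only [Set.mem_ofPred_eq, not_or] at hb
    rcases ha with rfl | rfl
    · have hl := I.isLink hab hb.1
      rcases fin_three_eq_or him hik hmk hb.1 with h | h <;> rw [h] at hl
      · exact (hb.2 (hw _ _ hl)).elim
      · exact (hno _ _ hl).elim
    · by_cases hbm : f b = m
      · exact (ht ⟨b, ⟨hbm, fun h => hne ⟨rfl, h⟩⟩, hab⟩).elim
      · have hl := I.isLink hab (fun h => hbm (h.trans a1.1))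
        rw [a1.1] at hl
        rcases fin_three_eq_or him.symm hmk hik hbm with h | h <;> rw [h] at hl
        · exact (hb.1 h).elim
        · exact ⟨b, hl⟩
  -- If class `k` has disjoint links at `w` and `v`, the walk enters it from `w` and returns through
  -- `v`. Otherwise a second link ends at the same `z`, and a triangle at `z` takes over.
  by_cases hM : ∃ v z z', G.IsLink d f m k w z ∧ G.IsLink d f m k v z' ∧ w ≠ v ∧ z ≠ z'
  · obtain ⟨v, z, Z, ⟨-, c2, c3⟩, ⟨e1, e2, e3⟩, hwv, hzZ⟩ := hM
    exact S.hasOrientation_of_pattern_perm him hik hmk [x, X, w, v, z, Z]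
      [(0, false), (0, true), (1, true), (1, false), (2, false), (2, true)]
      [(2, 0), (1, 2), (2, 4), (5, 3)] [(0, 1), (2, 3), (4, 5)]
      (by decide) (by simp [*]) (by simp [*, b3.symm, e3.symm]) (by simp [*])
  · obtain ⟨v, Z, hvw, hZ, hv⟩ := (S.exists_inner_adj_or_link I a1).resolve_left ht
    rcases fin_three_eq_or him.symm hmk hik hZ with h | h <;> rw [h] at hv
    · exact (hvw (hw _ _ hv.symm)).elim
    · have hzZ : z = Z := by
        by_contra hne
        exact hM ⟨v, z, Z, hz, hv, hvw.symm, hne⟩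
      subst hzZ
      rcases S.exists_inner_adj_or_link I hz.2.1 with ⟨Z, hZ, hadj⟩ | ⟨r, t, hr, htk, hl⟩
      · obtain ⟨-, c2, c3⟩ := hz
        obtain ⟨e1, -, e3⟩ := hv
        exact S.hasOrientation_of_pattern_perm him hik hmk [x, X, w, v, z, Z]
          [(0, false), (0, true), (1, true), (1, false), (2, true), (2, false)]
          [(2, 0), (1, 2), (2, 4), (4, 5), (4, 3)] [(0, 1), (2, 3), (4, 5)]
          (by decide) (by simp [*]) (by simp [*, b3.symm, e3.symm])
          (by simp [*, hvw.symm, hadj.ne])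
      · exfalso
        rcases fin_three_eq_or hik.symm hmk.symm him htk with h | h <;> rw [h] at hl
        · exact hno _ _ hl.symm
        · by_cases htw : t = w
          · subst htw
            exact hM ⟨v, r, z, hl.symm, hv, hvw.symm, hr⟩
          · exact hM ⟨t, z, r, hz, hl.symm, Ne.symm htw, hr.symm⟩

theorem hasOrientation_of_no_link [Finite V] (S : G.StarPartition d f) (I : G.IsolatedCenters d f)
    (him : i ≠ m) (hik : i ≠ k) (hmk : m ≠ k) (hno : ∀ a b, ¬ G.IsLink d f i k a b) :
    G.HasOrientation 11 := by
  have hno' : ∀ a b, ¬ G.IsLink d f k i a b := fun a b h => hno b a h.symm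
  rcases S.exists_splitEnd_or_portEnd I him hik hmk hno with ⟨w, W, hi⟩ | ⟨W, hi, hiW⟩ <;>
  rcases S.exists_splitEnd_or_portEnd I hmk.symm hik.symm him.symm hno' with
    ⟨v, U, hk⟩ | ⟨U, hk, hkU⟩
  · exact S.hasOrientation_of_split_split him hik hmk hi hk
  · by_cases hU : ∃ t, IsInner d f m t ∧ G.Adj U t
    · obtain ⟨t, ht, hadj⟩ := hU
      exact S.hasOrientation_of_split_port him hik hmk hi hk ht hadj.symm
    · exact S.hasOrientation_of_port_of_not_adj I hmk.symm hik.symm him.symm hno' hk hkU hU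
  · by_cases hW : ∃ t, IsInner d f m t ∧ G.Adj W t
    · obtain ⟨t, ht, hadj⟩ := hW
      exact S.hasOrientation_of_split_port hmk.symm hik.symm him.symm hk hi ht hadj.symm
    · exact S.hasOrientation_of_port_of_not_adj I him hik hmk hno hi hiW hW
  · by_cases hW : ∃ t, IsInner d f m t ∧ G.Adj W t
    · by_cases hU : ∃ t, IsInner d f m t ∧ G.Adj U t
      · obtain ⟨t, ht, hadj⟩ := hW
        obtain ⟨u, hu, hadj'⟩ := hU
        exact S.hasOrientation_of_port_port him hik hmk hi ht hadj.symm hk hu hadj'.symm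
      · exact S.hasOrientation_of_port_of_not_adj I hmk.symm hik.symm him.symm hno' hk hkU hU
    · exact S.hasOrientation_of_port_of_not_adj I him hik hmk hno hi hiW hW

theorem hasOrientation {V : Type} [Finite V] {G : SimpleGraph V} {d : Fin 3 → V} {f : V → Fin 3}
    (S : G.StarPartition d f) : G.HasOrientation 11 := by
  refine S.hasOrientation_of_isolatedCenters fun W _ G d f S I => ?_
  by_cases h01 : ∃ a b, G.IsLink d f 0 1 a b
  · by_cases h12 : ∃ a b, G.IsLink d f 1 2 a b
    · by_cases h20 : ∃ a b, G.IsLink d f 2 0 a b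
      · exact S.hasOrientation_of_links I h01 h12 h20
      · exact S.hasOrientation_of_no_link (i := 2) (m := 1) (k := 0) I (by decide) (by decide)
          (by decide) (by simpa using h20)
    · exact S.hasOrientation_of_no_link (i := 1) (m := 0) (k := 2) I (by decide) (by decide)
        (by decide) (by simpa using h12)
  · exact S.hasOrientation_of_no_link (i := 0) (m := 2) (k := 1) I (by decide) (by decide)
      (by decide) (by simpa using h01)

end StarPartition

/-! ### From dominating sets to the upper bound. -/

/-- A dominating set with three elements gives a partition into stars. -/
theorem TwoEdgeCuts.exists_starPartition {V : Type*} {G : SimpleGraph V} (hG : G.TwoEdgeCuts)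
    {D : Finset V} (hD : G.IsDominatingSet D) (hcard : D.card = 3) :
    ∃ d f, G.StarPartition d f := by
  classical
  let e : Fin 3 ≃ D := (D.equivFinOfCardEq hcard).symm
  have hf : ∀ v : V, ∃ i, v = e i ∨ (v ∉ D ∧ G.Adj (e i) v) := by
    intro v
    by_cases hv : v ∈ D
    · exact ⟨e.symm ⟨v, hv⟩, .inl (by simp)⟩
    · obtain ⟨u, hu, hadj⟩ := hD v hv
      exact ⟨e.symm ⟨u, hu⟩, .inr ⟨hv, by simpa using hadj.symm⟩⟩
  choose f hf using hf
  refine ⟨fun i => e i, f, fun i => ?_, fun x hx => ?_, hG⟩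
  · rcases hf (e i) with h | h
    · exact (e.injective (Subtype.ext h)).symm
    · exact (h.1 (e i).2).elim
  · exact ((hf x).resolve_left hx).2

theorem IsBridgelessConnected.minOrientedDiam_le {V : Type} [Finite V] {G : SimpleGraph V}
    (hG : G.IsBridgelessConnected) (hγ : G.dominationNumber ≤ 3) : G.minOrientedDiam ≤ 11 := by
  classical
  have := Fintype.ofFinite V
  have hcut := hG.twoEdgeCuts
  suffices h : G.HasOrientation 11 by simpa using h.minOrientedDiam_le
  obtain ⟨D, hD, hcard⟩ : ∃ D : Finset V, G.IsDominatingSet D ∧ D.card = G.dominationNumber :=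
    Nat.sInf_mem (s := {k : ℕ | ∃ D : Finset V, G.IsDominatingSet D ∧ D.card = k})
      ⟨_, Finset.univ, fun u hu => (hu (Finset.mem_univ u)).elim, rfl⟩
  by_cases h3 : 3 ≤ Fintype.card V
  · obtain ⟨D', hDD', hcard'⟩ := Finset.exists_superset_card_eq (hcard.trans_le hγ) h3
    have hD' : G.IsDominatingSet D' := fun u hu => by
      obtain ⟨v, hv, hadj⟩ := hD u fun h => hu (hDD' h)
      exact ⟨v, hDD' hv, hadj⟩
    obtain ⟨d, f, S⟩ := hcut.exists_starPartition hD' hcard'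
    exact S.hasOrientation
  -- On two vertices the only possible edge would be a bridge, so just one vertex remains.
  · have hsub : ∀ u v : V, u = v := by
      intro u v
      by_contra huv
      have hpair : ∀ w, w = u ∨ w = v := by
        intro w
        by_contra hw
        rw [not_or] at hw
        apply h3
        rw [← Finset.card_eq_three.2 ⟨u, v, w, huv, Ne.symm hw.1, Ne.symm hw.2, rfl⟩]
        exact Finset.card_le_univ _
      obtain ⟨a, ha, b, hb, -, hne⟩ := hcut {u} u v ⟨u, rfl⟩ ⟨v, Ne.symm huv⟩
      exact hne ⟨ha, (hpair b).resolve_left hb⟩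
    refine ⟨⟨fun _ _ => False⟩, fun _ _ h => h.elim, fun _ _ h => h.elim, fun u v => ?_⟩
    exact hsub u v ▸ .refl _ _ _

end SimpleGraph

/-! ### Completeness of the reachability computation. -/

namespace StarPattern

theorem testBit_foldl_of_testBit (S v : ℕ) (L : List (ℕ × ℕ)) (acc : ℕ)
    (h : acc.testBit v = true) :
    (L.foldl (fun acc p => if S.testBit p.1 then acc ||| (1 <<< p.2) else acc) acc).testBit v
      = true := by
  induction L generalizing acc with
  | nil => exact h
  | cons p L ih =>
    rw [List.foldl_cons]
    apply ih
    split_ifs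
    · rw [Nat.testBit_or, h, Bool.true_or]
    · exact h

theorem testBit_foldl_of_mem (S u v : ℕ) (L : List (ℕ × ℕ)) (acc : ℕ)
    (hu : S.testBit u = true) (h : (u, v) ∈ L) :
    (L.foldl (fun acc p => if S.testBit p.1 then acc ||| (1 <<< p.2) else acc) acc).testBit v
      = true := by
  induction L generalizing acc with
  | nil => cases h
  | cons p L ih =>
    rw [List.foldl_cons]
    rcases List.mem_cons.1 h with rfl | h
    · apply testBit_foldl_of_testBit
      simp only [hu, if_true]
      simp [Nat.testBit_or, Nat.one_shiftLeft]
    · exact ih _ h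

theorem testBit_reach_of_hasWalk (L : List (ℕ × ℕ)) {u v n : ℕ} (h : (digraph L).HasWalk u v n) :
    ∀ (m S : ℕ), (reach L m S).testBit u = true → (reach L (m + n) S).testBit v = true := by
  induction h with
  | nil => exact fun m S h => h
  | @cons u v w n huv _ ih =>
    intro m S h
    have := ih (m + 1) S (testBit_foldl_of_mem _ u v L _ h huv)
    rwa [Nat.add_right_comm] at this

theorem testBit_reach_of_near (L : List (ℕ × ℕ)) {u v n : ℕ} (h : (digraph L).Near n u v) :
    (reach L n (1 <<< u)).testBit v = true := by
  obtain ⟨a, ha, h⟩ := h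
  obtain ⟨b, rfl⟩ := Nat.exists_eq_add_of_le ha
  have h1 := testBit_reach_of_hasWalk L h 0 (1 <<< u)
    (by simp [reach, Nat.one_shiftLeft])
  rw [zero_add] at h1
  clear h ha
  induction b with
  | zero => exact h1
  | succ b ih => exact testBit_foldl_of_testBit _ _ _ _ ih

end StarPattern

/-! ### The extremal graph. -/

namespace CycleChain

open StarPattern

/-- The edge lists of six cycles that form a chain of blocks. -/
def cycle : Fin 6 → List (Fin 15 × Fin 15)
  | 0 => [(0, 3), (3, 4), (4, 0)]
  | 1 => [(0, 5), (5, 6), (6, 0)]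
  | 2 => [(5, 7), (7, 1), (1, 8), (8, 5)]
  | 3 => [(1, 9), (9, 11), (11, 10), (10, 1)]
  | 4 => [(11, 12), (12, 2), (2, 11)]
  | 5 => [(2, 13), (13, 14), (14, 2)]

/-- The edges of all six cycles. -/
def edges : List (Fin 15 × Fin 15) := (List.finRange 6).flatMap cycle

/-- The six cycles, with the orientation of those marked `false` reversed. -/
def orient (b : Fin 6 → Bool) : List (Fin 15 × Fin 15) :=
  (List.finRange 6).flatMap fun i => if b i then cycle i else (cycle i).map Prod.swap

/-- The pairs of a list, read as pairs of natural numbers. -/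
def toNat (L : List (Fin 15 × Fin 15)) : List (ℕ × ℕ) := L.map fun p => (p.1.val, p.2.val)

/-- The union of a chain of six cycles of lengths `3`, `3`, `4`, `4`, `3`, `3`, in which consecutive
cycles share one vertex. -/
def graph : SimpleGraph (Fin 15) where
  Adj u v := (u, v) ∈ edges ∨ (v, u) ∈ edges
  symm := ⟨fun _ _ h => h.symm⟩
  loopless := ⟨fun u h => by
    have : ∀ p ∈ edges, p.1 ≠ p.2 := by decide +kernel
    exact this _ (h.elim id id) rfl⟩

theorem isDominatingSet : graph.IsDominatingSet {0, 1, 2} := by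
  have : ∀ u : Fin 15, u ∉ ({0, 1, 2} : Finset (Fin 15)) → ∃ v ∈ ({0, 1, 2} : Finset (Fin 15)),
    (u, v) ∈ edges ∨ (v, u) ∈ edges := by decide +kernel
  exact this

theorem connected_deleteEdges {p : Fin 15 × Fin 15} (hp : p ∈ edges) :
    (graph.deleteEdges {s(p.1, p.2)}).Connected := by
  -- On 15 vertices, 14 steps suffice for reachability.
  have hreach : ∀ p ∈ edges, covers (reach (toNat (edges.filter (· ≠ p) ++
      (edges.filter (· ≠ p)).map Prod.swap)) 14 (1 <<< 0)) 15 = true := by decide +kernel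
  have hswap : ∀ p ∈ edges, ∀ q ∈ edges, q.swap ≠ p := by decide +kernel
  set L := edges.filter (· ≠ p) with hL
  have hadj : ∀ q ∈ L, (graph.deleteEdges {s(p.1, p.2)}).Adj q.1 q.2 := by
    intro q hq
    obtain ⟨hq, hqp⟩ := List.mem_filter.1 hq
    rw [SimpleGraph.deleteEdges_adj]
    refine ⟨.inl hq, ?_⟩
    rw [Set.mem_singleton_iff, Sym2.eq_iff]
    rintro (⟨h1, h2⟩ | ⟨h1, h2⟩)
    · exact (by simpa using hqp : q ≠ p) (Prod.ext h1 h2)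
    · exact hswap p hp q hq (Prod.ext h2 h1)
  have hmap : ∀ u v : ℕ, (digraph (toNat (L ++ L.map Prod.swap))).Adj u v →
      (graph.deleteEdges {s(p.1, p.2)}).Adj (Fin.ofNat 15 u) (Fin.ofNat 15 v) := by
    intro u v huv
    obtain ⟨q, hq, h⟩ := List.mem_map.1 huv
    obtain ⟨rfl, rfl⟩ := Prod.mk.inj h
    simp only [Fin.ofNat_val_eq_self]
    rcases List.mem_append.1 hq with hq | hq
    · exact hadj q hq
    · obtain ⟨r, hr, rfl⟩ := List.mem_map.1 hq
      exact (hadj r hr).symm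
  have hwalk : ∀ {u v n}, (digraph (toNat (L ++ L.map Prod.swap))).HasWalk u v n →
      (graph.deleteEdges {s(p.1, p.2)}).Reachable (Fin.ofNat 15 u) (Fin.ofNat 15 v) := by
    intro u v n h
    induction h with
    | nil => exact .rfl
    | cons huv _ ih => exact (hmap _ _ huv).reachable.trans ih
  have h0 : ∀ v, (graph.deleteEdges {s(p.1, p.2)}).Reachable 0 v := by
    intro v
    have h := hreach p hp
    rw [covers, List.all_eq_true] at h
    obtain ⟨n, -, hn⟩ := near_of_testBit_reach _ _ _ _ (h v.val (List.mem_range.2 v.isLt))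
    simpa using hwalk hn
  exact ⟨fun u v => (h0 u).symm.trans (h0 v)⟩

theorem isBridgelessConnected : graph.IsBridgelessConnected := by
  have hdel : ∀ e ∈ graph.edgeSet, (graph.deleteEdges {e}).Connected := by
    intro e
    induction e with
    | _ a b =>
      rintro (h | h)
      · exact connected_deleteEdges h
      · rw [Sym2.eq_swap]
        exact connected_deleteEdges h
  exact ⟨(connected_deleteEdges (p := (0, 3)) (by decide)).mono (SimpleGraph.deleteEdges_le _), hdel⟩

section Orientation

variable {H : Digraph (Fin 15)} {n : ℕ}

theorem _root_.Digraph.HasWalk.exists_adj_mem_notMem {V : Type*} {H : Digraph V} {u v : V} {n : ℕ}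
    (h : H.HasWalk u v n) {X : Set V} (hu : u ∈ X) (hv : v ∉ X) : ∃ a ∈ X, ∃ b ∉ X, H.Adj a b := by
  induction h with
  | nil => exact (hv hu).elim
  | @cons u w v n huw _ ih =>
    by_cases hw : w ∈ X
    · exact ih hw hv
    · exact ⟨u, hu, w, hw, huw⟩

/-- A strongly connected orientation traverses the two edges of a cut in opposite directions. -/
theorem adj_iff_of_cut (hH : H.IsOrientationOf graph) (hn : ∀ u v, H.Near n u v)
    (X : List (Fin 15)) (a b a' b' : Fin 15) (haX : a ∈ X) (hbX : b ∉ X)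
    (hX : ∀ p ∈ edges, (p.1 ∈ X → p.2 ∉ X → p = (a, b) ∨ p = (a', b')) ∧
      (p.2 ∈ X → p.1 ∉ X → p = (b, a) ∨ p = (b', a'))) : H.Adj a b ↔ H.Adj b' a' := by
  have hasymm : ∀ u v, H.Adj u v → ¬ H.Adj v u := by
    intro u v h h'
    have := hH.2 u v (hH.1 u v h)
    simp [h, h'] at this
  have hedge : ∀ u v, graph.Adj u v → u ∈ X → v ∉ X → u = a ∧ v = b ∨ u = a' ∧ v = b' := by
    rintro u v (h | h) hu hv
    · simpa using (hX _ h).1 hu hv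
    · simpa [and_comm] using (hX _ h).2 hu hv
  constructor
  · intro h
    obtain ⟨m, -, hm⟩ := hn b a
    obtain ⟨v, hv, u, hu, hvu⟩ := hm.exists_adj_mem_notMem (X := {v | v ∉ X}) hbX (· haX)
    rcases hedge u v (hH.1 _ _ hvu).symm (not_not.mp hu) hv with ⟨rfl, rfl⟩ | ⟨rfl, rfl⟩
    · exact (hasymm _ _ h hvu).elim
    · exact hvu
  · intro h
    obtain ⟨m, -, hm⟩ := hn a b
    obtain ⟨u, hu, v, hv, huv⟩ := hm.exists_adj_mem_notMem (X := {v | v ∈ X}) haX hbX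
    rcases hedge u v (hH.1 _ _ huv) hu hv with ⟨rfl, rfl⟩ | ⟨rfl, rfl⟩
    · exact huv
    · exact (hasymm _ _ h huv).elim

/-- In a strongly connected orientation each of the cycles is a directed cycle. -/
theorem exists_orient (hH : H.IsOrientationOf graph) (hn : ∀ u v, H.Near n u v) :
    ∃ b : Fin 6 → Bool, ∀ i, ∀ p ∈ cycle i, H.Adj p.1 p.2 ↔ b i = true := by
  -- Each cut meets a single cycle in two consecutive edges: it isolates a vertex of degree two, or
  -- one side of the chain at a cut vertex. One cut fewer than the length of each cycle links all
  -- its edges.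
  have e1 := adj_iff_of_cut hH hn [3] 3 4 3 0 (by decide) (by decide)
    (by decide +kernel)
  have e2 := adj_iff_of_cut hH hn [4] 4 0 4 3 (by decide) (by decide)
    (by decide +kernel)
  have e3 := adj_iff_of_cut hH hn [6] 6 0 6 5 (by decide) (by decide)
    (by decide +kernel)
  have e4 := adj_iff_of_cut hH hn [0, 3, 4] 0 5 0 6 (by decide) (by decide)
    (by decide +kernel)
  have e5 := adj_iff_of_cut hH hn [7] 7 1 7 5 (by decide) (by decide)
    (by decide +kernel)
  have e6 := adj_iff_of_cut hH hn [8] 8 5 8 1 (by decide) (by decide)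
    (by decide +kernel)
  have e7 := adj_iff_of_cut hH hn [0, 3, 4, 5, 6] 5 7 5 8 (by decide) (by decide)
    (by decide +kernel)
  have e8 := adj_iff_of_cut hH hn [9] 9 11 9 1 (by decide) (by decide)
    (by decide +kernel)
  have e9 := adj_iff_of_cut hH hn [10] 10 1 10 11 (by decide) (by decide)
    (by decide +kernel)
  have e10 := adj_iff_of_cut hH hn [2, 11, 12, 13, 14] 11 10 11 9 (by decide) (by decide)
    (by decide +kernel)
  have e11 := adj_iff_of_cut hH hn [12] 12 2 12 11 (by decide) (by decide)
    (by decide +kernel)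
  have e12 := adj_iff_of_cut hH hn [2, 13, 14] 2 11 2 12 (by decide) (by decide)
    (by decide +kernel)
  have e13 := adj_iff_of_cut hH hn [13] 13 14 13 2 (by decide) (by decide)
    (by decide +kernel)
  have e14 := adj_iff_of_cut hH hn [14] 14 2 14 13 (by decide) (by decide)
    (by decide +kernel)
  classical
  refine ⟨![decide (H.Adj 0 3), decide (H.Adj 0 5), decide (H.Adj 5 7), decide (H.Adj 1 9),
    decide (H.Adj 11 12), decide (H.Adj 2 13)], fun i => ?_⟩
  fin_cases i
  · simp [cycle, e1, e2]
  · simp [cycle, e3, e4]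
  · simp [cycle, e5, e6, e7]
  · simp [cycle, e8, e9, e10]
  · simp [cycle, e11, e12]
  · simp [cycle, e13, e14]

theorem near_orient (hH : H.IsOrientationOf graph) {b : Fin 6 → Bool}
    (hb : ∀ i, ∀ p ∈ cycle i, H.Adj p.1 p.2 ↔ b i = true) {u v : Fin 15} (h : H.Near n u v) :
    (digraph (toNat (orient b))).Near n u.val v.val := by
  refine h.map Fin.val fun u v huv => ?_
  refine List.mem_map.2 ⟨(u, v), ?_, rfl⟩
  have huv' := hH.1 u v huv
  have hxor := hH.2 u v huv'
  have hvu : ¬ H.Adj v u := fun h => by simp [huv, h] at hxor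
  rcases huv' with h | h <;> obtain ⟨i, hi, h⟩ := List.mem_flatMap.1 h <;>
    refine List.mem_flatMap.2 ⟨i, hi, ?_⟩
  · rw [if_pos ((hb i _ h).1 huv)]
    exact h
  · rw [if_neg fun hbi => hvu ((hb i _ h).2 hbi)]
    exact List.mem_map.2 ⟨(v, u), h, rfl⟩

/-- In each orientation of the six cycles two of the outer vertices are far apart. -/
theorem exists_not_testBit_reach (b : Fin 6 → Bool) :
    ∃ p ∈ [(3, 13), (3, 14), (4, 13), (4, 14), (13, 3), (13, 4), (14, 3), (14, 4)],
      (reach (toNat (orient b)) 10 (1 <<< p.1)).testBit p.2 = false := by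
  -- The 64 orientations are checked by evaluation. The listed pairs suffice, since the longest
  -- traversals in the two directions have total length 22.
  have key : ∀ b₀ b₁ b₂ b₃ b₄ b₅ : Bool,
      ∃ p ∈ [(3, 13), (3, 14), (4, 13), (4, 14), (13, 3), (13, 4), (14, 3), (14, 4)],
        (reach (toNat (orient ![b₀, b₁, b₂, b₃, b₄, b₅])) 10 (1 <<< p.1)).testBit p.2 = false := by
    decide +kernel
  have hb : b = ![b 0, b 1, b 2, b 3, b 4, b 5] := by
    funext i
    fin_cases i <;> rfl
  rw [hb]
  exact key _ _ _ _ _ _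

theorem eleven_le_minOrientedDiam : 11 ≤ graph.minOrientedDiam := by
  refine le_iInf₂ fun H hH => ?_
  by_contra hlt
  have hle : H.diam ≤ (10 : ℕ) := by
    have : H.diam < (10 : ℕ∞) + 1 := not_le.mp hlt
    exact Order.le_of_lt_add_one this
  have hn := Digraph.near_of_diam_le hle
  obtain ⟨b, hb⟩ := exists_orient hH hn
  obtain ⟨p, hp, hpr⟩ := exists_not_testBit_reach b
  have hlt : ∀ p ∈ [(3, 13), (3, 14), (4, 13), (4, 14), (13, 3), (13, 4), (14, 3), (14, 4)],
    p.1 < 15 ∧ p.2 < 15 := by decide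
  have := testBit_reach_of_near _ (near_orient hH hb (hn ⟨p.1, (hlt p hp).1⟩ ⟨p.2, (hlt p hp).2⟩))
  simp [hpr] at this

end Orientation

end CycleChain

/-! ### Combining both bounds. -/

theorem orientedDiamValues_three_le {x : ℕ∞} (hx : x ∈ orientedDiamValues 3) : x ≤ 11 := by
  obtain ⟨V, hV, G, hG, hγ, rfl⟩ := hx
  exact hG.minOrientedDiam_le hγ

theorem eleven_mem_orientedDiamValues : 11 ∈ orientedDiamValues 3 := by
  have hγ : CycleChain.graph.dominationNumber ≤ 3 :=
    Nat.sInf_le ⟨{0, 1, 2}, CycleChain.isDominatingSet, by decide⟩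
  exact ⟨Fin 15, inferInstance, CycleChain.graph, CycleChain.isBridgelessConnected, hγ,
    le_antisymm (CycleChain.isBridgelessConnected.minOrientedDiam_le hγ)
      CycleChain.eleven_le_minOrientedDiam⟩

/-- The maximum that defines `Ξ(3)` is attained, and it equals `11`. -/
theorem mainTheorem2 :
    IsGreatest (orientedDiamValues 3) (Xi 3) ∧ Xi 3 = 11 := by
  have h : IsGreatest (orientedDiamValues 3) 11 :=
    ⟨eleven_mem_orientedDiamValues, fun _ => orientedDiamValues_three_le⟩
  have hXi : Xi 3 = 11 := h.isLUB.sSup_eq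
  exact ⟨hXi ▸ h, hXi⟩
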